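/- **Theorem 4.1.** Let $G$ be a second countable, Hausdorff, ample groupoid with unit space $G^{(0)}$, range map $r$ and source map $s$. That is, $G$ is a small category in which every morphism is invertible, with a second countable Hausdorff topology for which composition and inversion are continuous, $G^{(0)}\subseteq G$ is the set of identity morphisms with the subspace topology, and $G$ has a basis of compact open bisections (compact open sets $B$ such that $r|_B$ and $s|_B$ are homeomorphisms onto open subsets of $G^{(0)}$). Suppose that $G$ is topologically principal, i.e. $\{u\in G^{(0)} : r(\gamma)=s(\gamma)=u \Rightarrow \gamma=u\}$ is dense in $G^{(0)}$, and minimal, i.e. $\{r(\gamma): s(\gamma)=u\}$ is dense in $G^{(0)}$ for every $u\in G^{(0)}$. Let $\mathcal B$ be a basis of the topology of $G^{(0)}$ consisting of compact open sets. Let $C_c(G)$ be the $*$-algebra of compactly supported continuous functions $G\to\mathbb C$ with $$(f*g)(\gamma)=\sum_{r(\eta)=r(\gamma)} f(\eta)\,g(\eta^{-1}\gamma),\qquad f^*(\gamma)=\overline{f(\gamma^{-1})},$$ and let $C^*_r(G)$ be its completion in the norm $\|f\|_r=\sup_{u\in G^{(0)}}\|\pi_u(f)\|$, where $\pi_u$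 is the representation of $C_c(G)$ on $\ell^2(\{\gamma : s(\gamma)=u\})$ given by $\pi_u(f)\delta_\gamma=\sum_{s(\eta)=r(\gamma)}f(\eta)\,\delta_{\eta\gamma}$. Regard $C_0(G^{(0)})$ as a subalgebra of $C^*_r(G)$ through the continuous extension of the map $C_c(G^{(0)})\to C_c(G)$ that extends functions by zero. Then the following are equivalent: 1. $C^*_r(G)$ is purely infinite; 2. every nonzero projection $p\in C_0(G^{(0)})$ with $\operatorname{supp}(p)\in\mathcal B$ is infinite in $C^*_r(G)$. Here a $C^*$-algebra $A$ is *purely infinite* if there are no characters (nonzero multiplicative linear functionals $A\to\mathbb C$) on $A$ and, for all positive $a,b\in A$, there is a sequence $(x_k)$ in $A$ with $x_k^*bx_k\to a$ in norm if and only if $a$ lies in the closed two-sided ideal $\overline{AbA}$ (the closed linear span of $\{xby : x,y\in A\}$). A projection $p\in A$ is *infinite* if there is $s\in A$ with $s^*s=p$ and $ss^*\lneq p$. -/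

import Mathlib

open CategoryTheory Topology Filter
open scoped ENNReal lp CompactlySupported ZeroAtInfty

universe u v

set_option linter.unusedSectionVars false

noncomputable section
namespace EtaleGroupoid

/-- The matrix `k` is bounded by `M`, with at most `n` nonzero entries in each row and column. -/
structure IsBanded {ι : Type*} (k : ι → ι → ℂ) (n : ℕ) (M : ℝ) : Prop where
  nonneg : 0 ≤ M
  norm_le : ∀ i j, ‖k i j‖ ≤ M
  row : ∀ i, {j | k i j ≠ 0}.encard ≤ n
  col : ∀ j, {i | k i j ≠ 0}.encard ≤ n

section Kernel
variable {ι : Type*} {k : ι → ι → ℂ} {n : ℕ} {M : ℝ}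

theorem IsBanded.row_finite (h : IsBanded k n M) (i : ι) : {j | k i j ≠ 0}.Finite :=
  Set.finite_of_encard_le_coe (h.row i)

theorem IsBanded.summable (h : IsBanded k n M) (ξ : ι → ℂ) (i : ι) :
    Summable fun j => k i j * ξ j := by
  refine summable_of_hasFiniteSupport ((h.row_finite i).subset fun j hj => ?_)
  exact left_ne_zero_of_mul hj

theorem IsBanded.tsum_eq (h : IsBanded k n M) (ξ : ι → ℂ) (i : ι) :
    ∑' j, k i j * ξ j = ∑ j ∈ (h.row_finite i).toFinset, k i j * ξ j := by
  refine tsum_eq_sum fun j hj => ?_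
  simp only [Set.Finite.mem_toFinset, Set.mem_ofPred_eq, not_not] at hj
  simp [hj]

theorem IsBanded.sum_sq_le (h : IsBanded k n M) (ξ : ℓ²(ι, ℂ)) (s : Finset ι) :
    ∑ i ∈ s, ‖∑' j, k i j * ξ j‖ ^ 2 ≤ (n * M * ‖ξ‖) ^ 2 := by
  classical
  set R : ι → Finset ι := fun i => (h.row_finite i).toFinset with hR
  have hRc : ∀ i, (R i).card ≤ n := fun i => by
    have := h.row i
    rw [(h.row_finite i).encard_eq_coe_toFinset_card] at this
    exact_mod_cast this
  have hnorm : ∀ t : Finset ι, ∑ j ∈ t, ‖ξ j‖ ^ 2 ≤ ‖ξ‖ ^ 2 := fun t => by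
    have := lp.sum_rpow_le_norm_rpow (p := 2) (by norm_num) ξ t
    simpa using this
  have h1 : ∀ i, ‖∑' j, k i j * ξ j‖ ^ 2 ≤ n * M ^ 2 * ∑ j ∈ R i, ‖ξ j‖ ^ 2 := fun i => by
    rw [h.tsum_eq]
    calc ‖∑ j ∈ R i, k i j * ξ j‖ ^ 2 ≤ (∑ j ∈ R i, M * ‖ξ j‖) ^ 2 := by
          gcongr
          refine (norm_sum_le _ _).trans (Finset.sum_le_sum fun j _ => ?_)
          rw [norm_mul]
          gcongr
          exact h.norm_le i j
      _ ≤ (R i).card * ∑ j ∈ R i, (M * ‖ξ j‖) ^ 2 := sq_sum_le_card_mul_sum_sq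
      _ ≤ n * ∑ j ∈ R i, (M * ‖ξ j‖) ^ 2 := by
          gcongr
          exact_mod_cast hRc i
      _ = _ := by simp only [mul_pow, ← Finset.mul_sum]; ring
  set U := s.biUnion R with hU
  have h2 : ∑ i ∈ s, ∑ j ∈ R i, ‖ξ j‖ ^ 2 ≤ n * ∑ j ∈ U, ‖ξ j‖ ^ 2 := by
    have : ∀ i ∈ s, ∑ j ∈ R i, ‖ξ j‖ ^ 2 = ∑ j ∈ U, if j ∈ R i then ‖ξ j‖ ^ 2 else 0 := by
      intro i hi
      rw [← Finset.sum_filter]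
      congr 1
      ext j
      simp only [hU, Finset.mem_filter, Finset.mem_biUnion]
      exact ⟨fun hj => ⟨⟨i, hi, hj⟩, hj⟩, fun hj => hj.2⟩
    rw [Finset.sum_congr rfl this, Finset.sum_comm, Finset.mul_sum]
    refine Finset.sum_le_sum fun j _ => ?_
    rw [← Finset.sum_filter, Finset.sum_const, nsmul_eq_mul]
    gcongr
    have hc : ((s.filter fun i => j ∈ R i : Finset ι) : Set ι).encard ≤ n := by
      refine (Set.encard_le_encard fun i hi => ?_).trans (h.col j)
      simpa [hR] using (Finset.mem_filter.1 hi).2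
    rw [Set.encard_coe_eq_coe_finsetCard] at hc
    exact_mod_cast hc
  calc ∑ i ∈ s, ‖∑' j, k i j * ξ j‖ ^ 2
      ≤ ∑ i ∈ s, n * M ^ 2 * ∑ j ∈ R i, ‖ξ j‖ ^ 2 := Finset.sum_le_sum fun i _ => h1 i
    _ = n * M ^ 2 * ∑ i ∈ s, ∑ j ∈ R i, ‖ξ j‖ ^ 2 := by rw [Finset.mul_sum]
    _ ≤ n * M ^ 2 * (n * ‖ξ‖ ^ 2) := by
        gcongr
        exact h2.trans (by gcongr; exact hnorm U)
    _ = _ := by ring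

/-- The bounded operator on `ℓ²(ι)` with matrix `k`. -/
def kernelOp (k : ι → ι → ℂ) (h : ∃ n M, IsBanded k n M) : ℓ²(ι, ℂ) →L[ℂ] ℓ²(ι, ℂ) :=
  LinearMap.mkContinuous
    { toFun := fun ξ => ⟨fun i => ∑' j, k i j * ξ j, by
        obtain ⟨n, M, h⟩ := h
        refine memℓp_gen' (C := (n * M * ‖ξ‖) ^ 2) fun s => ?_
        simpa using h.sum_sq_le ξ s⟩
      map_add' := fun ξ η => by
        obtain ⟨n, M, h⟩ := h
        ext i
        exact (tsum_congr fun j => mul_add _ _ _).trans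
          ((h.summable ξ i).tsum_add (h.summable η i))
      map_smul' := fun c ξ => by
        ext i
        simp [mul_left_comm, tsum_mul_left] }
    (h.choose * h.choose_spec.choose) fun ξ => by
      have hb := h.choose_spec.choose_spec
      refine lp.norm_le_of_forall_sum_le (by norm_num)
        (mul_nonneg (mul_nonneg (Nat.cast_nonneg _) hb.nonneg) (norm_nonneg _)) fun s => ?_
      simpa using hb.sum_sq_le ξ s

theorem kernelOp_apply (h : ∃ n M, IsBanded k n M) (ξ : ℓ²(ι, ℂ)) (i : ι) :
    kernelOp k h ξ i = ∑' j, k i j * ξ j := rfl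

theorem norm_kernelOp_le (h : IsBanded k n M) : ‖kernelOp k ⟨n, M, h⟩‖ ≤ n * M := by
  refine ContinuousLinearMap.opNorm_le_bound _ (mul_nonneg (Nat.cast_nonneg _) h.nonneg) fun ξ => ?_
  refine lp.norm_le_of_forall_sum_le (by norm_num)
    (mul_nonneg (mul_nonneg (Nat.cast_nonneg _) h.nonneg) (norm_nonneg _)) fun s => ?_
  simpa [kernelOp_apply] using h.sum_sq_le ξ s

theorem kernelOp_single [DecidableEq ι] (h : ∃ n M, IsBanded k n M) (i j : ι) :
    kernelOp k h (lp.single 2 j 1) i = k i j := by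
  rw [kernelOp_apply, tsum_eq_single j]
  · simp
  · intro b hb
    simp [lp.single_apply, hb]

theorem op_ext [DecidableEq ι] {S T : ℓ²(ι, ℂ) →L[ℂ] ℓ²(ι, ℂ)}
    (h : ∀ i j, S (lp.single 2 j 1) i = T (lp.single 2 j 1) i) : S = T := by
  ext1 ξ
  have hs := lp.hasSum_single (p := 2) (by norm_num) ξ
  refine (hs.mapL S).unique ?_
  convert hs.mapL T using 2 with j
  have : lp.single (E := fun _ : ι => ℂ) 2 j (ξ j) = ξ j • lp.single 2 j 1 := by
    rw [← lp.single_smul]; simp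
  simp only [this, map_smul]
  congr 1
  ext i
  exact h i j

theorem adjoint_single [DecidableEq ι] (T : ℓ²(ι, ℂ) →L[ℂ] ℓ²(ι, ℂ)) (i j : ι) :
    (star T) (lp.single 2 j 1) i = star (T (lp.single 2 i 1) j) := by
  have := ContinuousLinearMap.adjoint_inner_right T (lp.single 2 i 1) (lp.single 2 j 1)
  rw [lp.inner_single_left, lp.inner_single_right] at this
  simpa [ContinuousLinearMap.star_eq_adjoint] using this
end Kernel

/-- The set of all morphisms of a groupoid with object set `X`. -/
@[ext] structure Mor (X : Type u) [Groupoid.{v} X] where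
  /-- the source of a morphism -/
  src : X
  /-- the range of a morphism -/
  rng : X
  /-- the morphism itself -/
  hom : src ⟶ rng

namespace Mor
variable {X : Type u} [Groupoid.{v} X]

/-- The identity morphism at `x`. -/
def one (x : X) : Mor X := ⟨x, x, 𝟙 x⟩

/-- The inverse of a morphism. -/
def inv (γ : Mor X) : Mor X := ⟨γ.rng, γ.src, Groupoid.inv γ.hom⟩

/-- The product `γ η` of two composable morphisms (first `η`, then `γ`). -/
def mul (γ η : Mor X) (h : γ.src = η.rng) : Mor X :=
  ⟨η.src, γ.rng, η.hom ≫ eqToHom h.symm ≫ γ.hom⟩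

@[simp] theorem one_src (x : X) : (one x).src = x := rfl
@[simp] theorem one_rng (x : X) : (one x).rng = x := rfl
@[simp] theorem inv_src (γ : Mor X) : γ.inv.src = γ.rng := rfl
@[simp] theorem inv_rng (γ : Mor X) : γ.inv.rng = γ.src := rfl
@[simp] theorem mul_src (γ η : Mor X) (h : γ.src = η.rng) : (mul γ η h).src = η.src := rfl
@[simp] theorem mul_rng (γ η : Mor X) (h : γ.src = η.rng) : (mul γ η h).rng = γ.rng := rfl

@[simp] theorem inv_inv (γ : Mor X) : γ.inv.inv = γ := by
  obtain ⟨x, y, g⟩ := γ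
  simp [inv]

@[simp] theorem inv_one (x : X) : (one x).inv = one x := by
  simp [inv, one]

theorem inv_mul (γ η : Mor X) (h : γ.src = η.rng) :
    (mul γ η h).inv = mul η.inv γ.inv h.symm := by
  obtain ⟨x, y, g⟩ := γ
  obtain ⟨z, w, k⟩ := η
  obtain rfl : x = w := h
  simp [inv, mul]

theorem mul_assoc (γ η ξ : Mor X) (h : γ.src = η.rng) (h' : η.src = ξ.rng) :
    mul (mul γ η h) ξ h' = mul γ (mul η ξ h') h := by
  obtain ⟨x, y, g⟩ := γ
  obtain ⟨z, w, k⟩ := η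
  obtain ⟨a, b, l⟩ := ξ
  obtain rfl : x = w := h
  obtain rfl : z = b := h'
  simp [mul]
  exact congrArg (l ≫ ·) (Category.id_comp _)

theorem inv_mul_cancel_left (γ η : Mor X) (h : γ.src = η.rng) :
    mul γ.inv (mul γ η h) rfl = η := by
  obtain ⟨x, y, g⟩ := γ
  obtain ⟨z, w, k⟩ := η
  obtain rfl : x = w := h
  simp [inv, mul]

theorem mul_inv_cancel_left (γ η : Mor X) (h : γ.rng = η.rng) :
    mul γ (mul γ.inv η h) rfl = η := by
  obtain ⟨x, y, g⟩ := γ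
  obtain ⟨z, w, k⟩ := η
  obtain rfl : y = w := h
  simp [inv, mul]

theorem mul_inv_cancel_right (γ η : Mor X) (h : γ.src = η.rng) :
    mul (mul γ η h) η.inv rfl = γ := by
  obtain ⟨x, y, g⟩ := γ
  obtain ⟨z, w, k⟩ := η
  obtain rfl : x = w := h
  simp [inv, mul]

theorem inv_mul_cancel_right (γ η : Mor X) (h : γ.src = η.src) :
    mul (mul γ η.inv h) η rfl = γ := by
  obtain ⟨x, y, g⟩ := γ
  obtain ⟨z, w, k⟩ := η
  obtain rfl : x = z := h
  simp [inv, mul]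
  exact (congrArg (k ≫ ·) (Category.id_comp _)).trans (by simp)

theorem mul_inv_mul_aux (γ η : Mor X) (h : γ.src = η.rng) :
    mul (mul γ η h).inv γ rfl = η.inv := by
  simp only [inv_mul]
  exact inv_mul_cancel_right η.inv γ h.symm

theorem mul_mul_inv_aux (γ η : Mor X) (h : η.src = γ.rng) :
    mul γ (mul η γ h).inv rfl = η.inv := by
  simp only [inv_mul]
  exact mul_inv_cancel_left γ η.inv h.symm

theorem mul_inv_inv_mul (γ ζ : Mor X) (h : γ.src = ζ.src) :
    mul (mul γ ζ.inv h).inv γ rfl = ζ := by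
  rw [mul_inv_mul_aux γ ζ.inv h, inv_inv]

theorem mul_inv_mul_inv (γ η : Mor X) (h : η.rng = γ.rng) :
    mul γ (mul η.inv γ h).inv rfl = η := by
  rw [mul_mul_inv_aux γ η.inv h, inv_inv]

theorem inv_mul_self (γ : Mor X) : mul γ.inv γ rfl = one γ.src := by
  obtain ⟨x, y, g⟩ := γ
  simp [inv, mul, one]
  exact (congrArg (g ≫ ·) (Category.id_comp _)).trans (by simp)

theorem mul_inv_self (γ : Mor X) : mul γ γ.inv rfl = one γ.rng := by
  obtain ⟨x, y, g⟩ := γ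
  simp [inv, mul, one]

theorem mul_inv_eq_one {γ η : Mor X} (h : γ.src = η.src) {x : X}
    (h1 : mul γ η.inv h = one x) : γ = η := by
  obtain ⟨y, z, g⟩ := γ
  obtain ⟨y', z', k⟩ := η
  obtain rfl : y = y' := h
  obtain rfl : z' = x := congrArg src h1
  obtain rfl : z = z' := congrArg rng h1
  have h2 : Groupoid.inv k ≫ g = 𝟙 z := by
    simpa [mul, inv, one] using h1
  have h3 : k ≫ Groupoid.inv k ≫ g = k := by rw [h2, Category.comp_id]
  simp only [← Category.assoc, Groupoid.comp_inv, Category.id_comp] at h3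
  rw [h3]

end Mor

/-- A topological groupoid: composition and inversion are continuous (inversion is then a
homeomorphism, being its own inverse), and the object space `X`, identified with the set of
identity morphisms, carries the subspace topology. -/
class IsTopologicalGroupoid (X : Type u) [Groupoid.{v} X] [TopologicalSpace X]
    [TopologicalSpace (Mor X)] : Prop where
  isEmbedding_one : IsEmbedding (Mor.one : X → Mor X)
  continuous_inv : Continuous (Mor.inv : Mor X → Mor X)
  continuous_mul : Continuous fun p : {p : Mor X × Mor X // p.1.src = p.2.rng} =>
    Mor.mul p.1.1 p.1.2 p.2

/-- An étale groupoid: the source map is a local homeomorphism. -/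
class IsEtaleGroupoid (X : Type u) [Groupoid.{v} X] [TopologicalSpace X]
    [TopologicalSpace (Mor X)] : Prop extends IsTopologicalGroupoid X where
  isLocalHomeomorph_src : IsLocalHomeomorph (Mor.src : Mor X → X)

/-- An open bisection: an open set on which source and range are homeomorphisms onto open subsets
of the unit space. -/
def IsOpenBisection {X : Type u} [Groupoid.{v} X] [TopologicalSpace X] [TopologicalSpace (Mor X)]
    (B : Set (Mor X)) : Prop :=
  IsOpen B ∧ IsOpenEmbedding (B.domRestrict Mor.src) ∧ IsOpenEmbedding (B.domRestrict Mor.rng)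

/-- An ample groupoid: a topological groupoid with a basis of compact open bisections. -/
class IsAmpleGroupoid (X : Type u) [Groupoid.{v} X] [TopologicalSpace X]
    [TopologicalSpace (Mor X)] : Prop extends IsTopologicalGroupoid X where
  exists_basis : ∃ S : Set (Set (Mor X)), TopologicalSpace.IsTopologicalBasis S ∧
    ∀ B ∈ S, IsCompact B ∧ IsOpenBisection B

/-- Topologically principal: the units with trivial isotropy are dense in the unit space. -/
def IsTopologicallyPrincipal (X : Type u) [Groupoid.{v} X] [TopologicalSpace X] : Prop :=
  Dense {x : X | ∀ g : x ⟶ x, g = 𝟙 x}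

/-- Minimal: every orbit is dense in the unit space. -/
def IsMinimal (X : Type u) [Groupoid.{v} X] [TopologicalSpace X] : Prop :=
  ∀ x : X, Dense {y : X | Nonempty (x ⟶ y)}

section Topology
variable {X : Type u} [Groupoid.{v} X] [TopologicalSpace X] [TopologicalSpace (Mor X)]

instance IsAmpleGroupoid.isEtaleGroupoid [IsAmpleGroupoid X] : IsEtaleGroupoid X where
  isLocalHomeomorph_src := by
    obtain ⟨S, hS, hB⟩ := IsAmpleGroupoid.exists_basis (X := X)
    rw [isLocalHomeomorph_iff_isOpenEmbedding_restrict]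
    intro γ
    obtain ⟨B, hBS, hγ, -⟩ := hS.exists_subset_of_mem_open (Set.mem_univ γ) isOpen_univ
    exact ⟨B, (hS.isOpen hBS).mem_nhds hγ, (hB B hBS).2.2.1⟩

instance IsAmpleGroupoid.locallyCompactSpace [IsAmpleGroupoid X] :
    LocallyCompactSpace (Mor X) where
  local_compact_nhds γ N hN := by
    obtain ⟨S, hS, hB⟩ := IsAmpleGroupoid.exists_basis (X := X)
    obtain ⟨B, hBS, hγ, hBN⟩ := hS.mem_nhds_iff.1 hN
    exact ⟨B, (hS.isOpen hBS).mem_nhds hγ, hBN, (hB B hBS).1⟩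

variable [IsEtaleGroupoid X]

theorem isLocalHomeomorph_rng : IsLocalHomeomorph (Mor.rng : Mor X → X) := by
  have hi := IsTopologicalGroupoid.continuous_inv (X := X)
  let e : Mor X ≃ₜ Mor X := ⟨⟨Mor.inv, Mor.inv, Mor.inv_inv, Mor.inv_inv⟩, hi, hi⟩
  exact (IsEtaleGroupoid.isLocalHomeomorph_src (X := X)).comp e.isLocalHomeomorph

theorem continuous_src : Continuous (Mor.src : Mor X → X) :=
  IsEtaleGroupoid.isLocalHomeomorph_src.continuous

theorem continuous_rng : Continuous (Mor.rng : Mor X → X) :=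
  isLocalHomeomorph_rng.continuous

theorem isOpenEmbedding_one : IsOpenEmbedding (Mor.one : X → Mor X) :=
  (IsEtaleGroupoid.isLocalHomeomorph_src (X := X)).isOpenEmbedding_of_comp
    IsOpenEmbedding.id IsTopologicalGroupoid.isEmbedding_one.continuous

theorem t2Space_unit [T2Space (Mor X)] : T2Space X :=
  (isOpenEmbedding_one (X := X)).isEmbedding.t2Space

theorem isClosed_range_one [T2Space (Mor X)] : IsClosed (Set.range (Mor.one : X → Mor X)) := by
  have : Set.range (Mor.one : X → Mor X) = {γ | Mor.one γ.src = γ} := by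
    ext γ
    constructor
    · rintro ⟨x, rfl⟩
      rfl
    · exact fun h => ⟨_, h⟩
  rw [this]
  exact isClosed_eq ((isOpenEmbedding_one (X := X)).continuous.comp continuous_src) continuous_id

/-- A compact set meets the fibres of a local homeomorphism in boundedly many points. -/
theorem exists_encard_le {Y Z : Type*} [TopologicalSpace Y] [TopologicalSpace Z] {p : Y → Z}
    (hp : IsLocalHomeomorph p) {K : Set Y} (hK : IsCompact K) :
    ∃ n : ℕ, ∀ z, (K ∩ p ⁻¹' {z}).encard ≤ n := by
  choose e he hpe using hp
  obtain ⟨t, ht⟩ := hK.elim_finite_subcover (fun y => (e y).source) (fun y => (e y).open_source)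
    fun y _ => Set.mem_iUnion.2 ⟨y, he y⟩
  refine ⟨t.card, fun z => ?_⟩
  have hc : ∀ y ∈ K, ∃ i ∈ t, y ∈ (e i).source := fun y hy => by
    simpa using ht hy
  choose! c hct hcs using hc
  rw [← Set.encard_coe_eq_coe_finsetCard]
  refine Set.encard_le_encard_of_injOn (f := c) (fun y hy => hct y hy.1) ?_
  rintro y ⟨hyK, hy⟩ y' ⟨hyK', hy'⟩ hcc
  refine (e (c y)).injOn (hcs y hyK) (hcc ▸ hcs y' hyK') ?_
  rw [← hpe]
  exact (Set.mem_singleton_iff.1 hy).trans (Set.mem_singleton_iff.1 hy').symm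

/-- The convolution `(f * g)(γ) = ∑_{r(η) = r(γ)} f(η) g(η⁻¹ γ)`. -/
def conv (f g : Mor X → ℂ) (γ : Mor X) : ℂ :=
  ∑' η : {η : Mor X // η.rng = γ.rng}, f η.1 * g (Mor.mul η.1.inv γ η.2)

end Topology
section Convolution
variable {X : Type u} [Groupoid.{v} X] [TopologicalSpace X] [TopologicalSpace (Mor X)]
variable [IsEtaleGroupoid X]

theorem conv_eq_of_source {e : OpenPartialHomeomorph (Mor X) X} (he : (Mor.rng : Mor X → X) = e)
    {f : Mor X → ℂ} (hf : tsupport f ⊆ e.source) (g : Mor X → ℂ) (γ η : Mor X)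
    (hη : η ∈ e.source) (h : η.rng = γ.rng) :
    conv f g γ = f η * g (Mor.mul η.inv γ h) := by
  refine tsum_eq_single (⟨η, h⟩ : {η : Mor X // η.rng = γ.rng}) fun ζ hζ => ?_
  have : f ζ.1 = 0 := by
    by_contra hne
    refine hζ (Subtype.ext (e.injOn (hf (subset_closure hne)) hη ?_))
    rw [← he]
    exact ζ.2.trans h.symm
  rw [this, zero_mul]

theorem conv_ne_zero {f g : Mor X → ℂ} {γ : Mor X} (h : conv f g γ ≠ 0) :
    ∃ (η : Mor X) (h : η.rng = γ.rng), f η ≠ 0 ∧ g (Mor.mul η.inv γ h) ≠ 0 := by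
  by_contra! hc
  refine h ((tsum_congr fun η => ?_).trans tsum_zero)
  by_cases hf : f η.1 = 0
  · rw [hf, zero_mul]
  · rw [hc η.1 η.2 hf, mul_zero]

theorem continuous_conv_aux [T2Space (Mor X)] {e : OpenPartialHomeomorph (Mor X) X}
    (he : (Mor.rng : Mor X → X) = e) {f g : Mor X → ℂ} (hfc : Continuous f)
    (hfs : HasCompactSupport f) (hf : tsupport f ⊆ e.source) (hg : Continuous g) :
    Continuous (conv f g) := by
  have := t2Space_unit (X := X)
  set O : Set (Mor X) := Mor.rng ⁻¹' e.target with hO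
  have hOo : IsOpen O := e.open_target.preimage continuous_rng
  have hcl : IsClosed (Mor.rng '' tsupport f) := (hfs.isCompact.image continuous_rng).isClosed
  have hsub : tsupport (conv f g) ⊆ O := by
    refine (closure_minimal (fun γ hγ => ?_) (hcl.preimage continuous_rng)).trans
      (Set.preimage_mono ?_)
    · obtain ⟨η, h, hη, -⟩ := conv_ne_zero hγ
      exact ⟨η, subset_closure hη, h⟩
    · rintro _ ⟨η, hη, rfl⟩
      rw [he]
      exact e.map_source (hf hη)
  have hr : ∀ x ∈ e.target, (e.symm x).rng = x := fun x hx => by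
    have := e.right_inv hx
    rwa [← he] at this
  have hon : ContinuousOn (conv f g) O := by
    rw [continuousOn_iff_continuous_domRestrict]
    have heq : O.domRestrict (conv f g) = fun γ : O =>
        f (e.symm γ.1.rng) * g (Mor.mul (e.symm γ.1.rng).inv γ.1 (hr _ γ.2)) := by
      funext γ
      exact conv_eq_of_source he hf g γ.1 _ (e.map_target γ.2) _
    rw [heq]
    have hs : Continuous fun γ : O => e.symm γ.1.rng :=
      e.continuousOn_symm.comp_continuous (continuous_rng.comp continuous_subtype_val)
        fun γ => γ.2
    refine (hfc.comp hs).mul (hg.comp ?_)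
    exact (IsTopologicalGroupoid.continuous_mul (X := X)).comp
      (f := fun γ : O => (⟨((e.symm γ.1.rng).inv, γ.1), hr _ γ.2⟩ :
        {p : Mor X × Mor X // p.1.src = p.2.rng}))
      (((IsTopologicalGroupoid.continuous_inv.comp hs).prodMk continuous_subtype_val).subtype_mk _)
  exact continuous_of_tsupport fun γ hγ => hon.continuousAt (hOo.mem_nhds (hsub hγ))

theorem continuous_conv [T2Space (Mor X)] [LocallyCompactSpace (Mor X)] {f g : Mor X → ℂ}
    (hfc : Continuous f) (hfs : HasCompactSupport f) (hg : Continuous g) :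
    Continuous (conv f g) := by
  choose e he hpe using isLocalHomeomorph_rng (X := X)
  obtain ⟨t, ht⟩ := hfs.isCompact.elim_finite_subcover (fun γ => (e γ).source)
    (fun γ => (e γ).open_source) fun γ _ => Set.mem_iUnion.2 ⟨γ, he γ⟩
  let c : Fin t.card → Mor X := fun i => (t.equivFin.symm i).1
  obtain ⟨ρ, hρs, hρ1, -, -⟩ := exists_continuous_sum_one_of_isOpen_isCompact
    (s := fun i => (e (c i)).source) (t := tsupport f) (fun i => (e (c i)).open_source)
    hfs.isCompact (fun γ hγ => by
      obtain ⟨η, hη, hγη⟩ := Set.mem_iUnion₂.1 (ht hγ)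
      exact Set.mem_iUnion.2 ⟨t.equivFin ⟨η, hη⟩, by simpa [c] using hγη⟩)
  have hsum : ∀ η, f η = ∑ i, (ρ i η : ℂ) * f η := fun η => by
    rw [← Finset.sum_mul]
    by_cases hη : η ∈ tsupport f
    · have := hρ1 hη
      simp only [Finset.sum_apply, Pi.one_apply] at this
      rw [← Complex.ofReal_sum, this]
      simp
    · rw [image_eq_zero_of_notMem_tsupport hη, mul_zero]
  have hfin : ∀ (i) (γ : Mor X), Summable fun η : {η : Mor X // η.rng = γ.rng} =>
      (ρ i η.1 : ℂ) * f η.1 * g (Mor.mul η.1.inv γ η.2) := fun i γ => by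
    obtain ⟨n, hn⟩ := exists_encard_le (isLocalHomeomorph_rng (X := X)) hfs.isCompact
    refine summable_of_hasFiniteSupport (Set.Finite.subset ((Set.finite_of_encard_le_coe
      (hn γ.rng)).preimage Subtype.val_injective.injOn) fun η hη => ?_)
    exact ⟨subset_closure (right_ne_zero_of_mul (left_ne_zero_of_mul hη)), η.2⟩
  have hconv : conv f g = fun γ => ∑ i, conv (fun η => (ρ i η : ℂ) * f η) g γ := by
    funext γ
    unfold conv
    rw [← Summable.tsum_finsetSum fun i _ => hfin i γ]
    refine tsum_congr fun η => ?_
    rw [← Finset.sum_mul, ← hsum]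
  rw [hconv]
  refine continuous_finsetSum _ fun i _ => ?_
  have hc : Continuous fun η => (ρ i η : ℂ) * f η :=
    (Complex.continuous_ofReal.comp (ρ i).continuous).mul hfc
  refine continuous_conv_aux (hpe (c i)) hc hfs.mul_left ?_ hg
  refine (tsupport_mul_subset_left (f := fun η => (ρ i η : ℂ))).trans ((closure_mono ?_).trans
    (hρs i))
  intro η hη h0
  exact hη (by simp [h0])

theorem hasCompactSupport_conv [T2Space (Mor X)] {f g : Mor X → ℂ}
    (hfs : HasCompactSupport f) (hgs : HasCompactSupport g) : HasCompactSupport (conv f g) := by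
  have := t2Space_unit (X := X)
  set P : Set {p : Mor X × Mor X // p.1.src = p.2.rng} :=
    Subtype.val ⁻¹' (tsupport f ×ˢ tsupport g) with hP
  have hPc : IsCompact P := by
    have hcl : IsClosed {p : Mor X × Mor X | p.1.src = p.2.rng} :=
      isClosed_eq (continuous_src.comp continuous_fst) (continuous_rng.comp continuous_snd)
    exact hcl.isClosedEmbedding_subtypeVal.isCompact_preimage (hfs.isCompact.prod hgs.isCompact)
  refine HasCompactSupport.intro
    (hPc.image (IsTopologicalGroupoid.continuous_mul (X := X))) fun γ hγ => ?_
  by_contra hne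
  obtain ⟨η, h, h1, h2⟩ := conv_ne_zero hne
  refine hγ ⟨⟨(η, Mor.mul η.inv γ h), rfl⟩, ⟨subset_closure h1, subset_closure h2⟩, ?_⟩
  exact Mor.mul_inv_cancel_left η γ h

variable [T2Space (Mor X)]

/-- The product of the convolution algebra `C_c(G)`. -/
def convolution [LocallyCompactSpace (Mor X)] (f g : C_c(Mor X, ℂ)) : C_c(Mor X, ℂ) where
  toFun := conv f g
  continuous_toFun := continuous_conv f.continuous f.hasCompactSupport g.continuous
  hasCompactSupport' := hasCompactSupport_conv f.hasCompactSupport g.hasCompactSupport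

/-- The involution `f*(γ) = conj (f(γ⁻¹))` of the convolution algebra `C_c(G)`. -/
def involution (f : C_c(Mor X, ℂ)) : C_c(Mor X, ℂ) where
  toFun γ := star (f γ.inv)
  continuous_toFun := continuous_star.comp
    (f.continuous.comp IsTopologicalGroupoid.continuous_inv)
  hasCompactSupport' := by
    have hi := IsTopologicalGroupoid.continuous_inv (X := X)
    refine HasCompactSupport.intro (f.hasCompactSupport.isCompact.image hi) fun γ hγ => ?_
    have : f γ.inv = 0 := by
      by_contra hne
      exact hγ ⟨γ.inv, subset_closure hne, γ.inv_inv⟩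
    simp [this]

end Convolution

section Regular
variable {X : Type u} [Groupoid.{v} X]

/-- The set `Gx` of all morphisms with source `x`. -/
abbrev Fiber (x : X) : Type (max u v) := {γ : Mor X // γ.src = x}

/-- The matrix of the regular representation at `x`: its `(γ, ζ)` entry is `f(γ ζ⁻¹)`. -/
def regularKernel (f : Mor X → ℂ) (x : X) (γ ζ : Fiber x) : ℂ :=
  f (Mor.mul γ.1 ζ.1.inv (γ.2.trans ζ.2.symm))

variable [TopologicalSpace X] [TopologicalSpace (Mor X)] [IsEtaleGroupoid X]

theorem exists_isBanded (f : C_c(Mor X, ℂ)) :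
    ∃ n M, ∀ x, IsBanded (regularKernel f x) n M := by
  have hK := f.hasCompactSupport.isCompact
  obtain ⟨n, hn⟩ := exists_encard_le (isLocalHomeomorph_rng (X := X)) hK
  obtain ⟨m, hm⟩ := exists_encard_le (IsEtaleGroupoid.isLocalHomeomorph_src (X := X)) hK
  obtain ⟨M, hM⟩ := f.hasCompactSupport.exists_bound_of_continuous f.continuous
  refine ⟨max n m, max M 0, fun x => ⟨le_max_right _ _, fun γ ζ => (hM _).trans (le_max_left _ _),
    fun γ => ?_, fun ζ => ?_⟩⟩
  · refine (Set.encard_le_encard_of_injOn (f := fun ζ : Fiber x =>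
      Mor.mul γ.1 ζ.1.inv (γ.2.trans ζ.2.symm)) (t := tsupport f ∩ Mor.rng ⁻¹' {γ.1.rng})
      (fun ζ hζ => ⟨subset_closure hζ, rfl⟩) ?_).trans
      ((hn _).trans (by exact_mod_cast le_max_left n m))
    rintro ζ - ζ' - h
    have h1 := Mor.inv_mul_cancel_left γ.1 ζ.1.inv (γ.2.trans ζ.2.symm)
    have h2 := Mor.inv_mul_cancel_left γ.1 ζ'.1.inv (γ.2.trans ζ'.2.symm)
    have h3 : ζ.1.inv = ζ'.1.inv := by
      rw [← h1, ← h2]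
      congr 1
    exact Subtype.ext (by rw [← ζ.1.inv_inv, h3, Mor.inv_inv])
  · refine (Set.encard_le_encard_of_injOn (f := fun γ : Fiber x =>
      Mor.mul γ.1 ζ.1.inv (γ.2.trans ζ.2.symm)) (t := tsupport f ∩ Mor.src ⁻¹' {ζ.1.rng})
      (fun γ hγ => ⟨subset_closure hγ, rfl⟩) ?_).trans
      ((hm _).trans (by exact_mod_cast le_max_right n m))
    rintro γ - γ' - h
    have h1 := Mor.inv_mul_cancel_right γ.1 ζ.1 (γ.2.trans ζ.2.symm)
    have h2 := Mor.inv_mul_cancel_right γ'.1 ζ.1 (γ'.2.trans ζ.2.symm)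
    refine Subtype.ext ?_
    rw [← h1, ← h2]
    congr 1

/-- The regular representation `π_x` of `C_c(G)` on `ℓ²(Gx)`:
`(π_x(f) ξ)(γ) = ∑_{ζ ∈ Gx} f(γ ζ⁻¹) ξ(ζ)`, that is `π_x(f) δ_γ = ∑_{s(η) = r(γ)} f(η) δ_{ηγ}`. -/
def regularRep (x : X) (f : C_c(Mor X, ℂ)) : ℓ²(Fiber x, ℂ) →L[ℂ] ℓ²(Fiber x, ℂ) :=
  kernelOp (regularKernel f x) <| by
    obtain ⟨n, M, h⟩ := exists_isBanded f
    exact ⟨n, M, h x⟩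

theorem exists_norm_regularRep_le (f : C_c(Mor X, ℂ)) : ∃ C, ∀ x, ‖regularRep x f‖ ≤ C := by
  obtain ⟨n, M, h⟩ := exists_isBanded f
  exact ⟨n * M, fun x => norm_kernelOp_le (h x)⟩

theorem regularRep_single (x : X) [DecidableEq (Fiber x)] (f : C_c(Mor X, ℂ)) (γ ζ : Fiber x) :
    regularRep x f (lp.single 2 ζ 1) γ = regularKernel f x γ ζ :=
  kernelOp_single _ γ ζ

theorem regularRep_involution [T2Space (Mor X)] (x : X) (f : C_c(Mor X, ℂ)) :
    regularRep x (involution f) = star (regularRep x f) := by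
  classical
  refine op_ext fun γ ζ => ?_
  rw [adjoint_single, regularRep_single, regularRep_single]
  change star (f (Mor.inv _)) = star (f _)
  rw [Mor.inv_mul]
  simp only [Mor.inv_inv]

theorem regularRep_convolution [T2Space (Mor X)] [LocallyCompactSpace (Mor X)] (x : X)
    (f g : C_c(Mor X, ℂ)) :
    regularRep x (convolution f g) = regularRep x f * regularRep x g := by
  classical
  refine op_ext fun γ θ => ?_
  rw [regularRep_single, mul_apply_eq_comp]
  change _ = ∑' ζ, regularKernel f x γ ζ * regularRep x g (lp.single 2 θ 1) ζ
  simp only [regularRep_single]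
  set δ := Mor.mul γ.1 θ.1.inv (γ.2.trans θ.2.symm) with hδ
  change ∑' η : {η : Mor X // η.rng = δ.rng}, f η.1 * g (Mor.mul η.1.inv δ η.2) = _
  let E : Fiber x ≃ {η : Mor X // η.rng = δ.rng} :=
    { toFun := fun ζ => ⟨Mor.mul γ.1 ζ.1.inv (γ.2.trans ζ.2.symm), rfl⟩
      invFun := fun η => ⟨Mor.mul η.1.inv γ.1 η.2, γ.2⟩
      left_inv := fun ζ => by
        refine Subtype.ext ?_
        exact Mor.mul_inv_inv_mul γ.1 ζ.1 (γ.2.trans ζ.2.symm)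
      right_inv := fun η => by
        refine Subtype.ext ?_
        exact Mor.mul_inv_mul_inv γ.1 η.1 η.2 }
  rw [← E.tsum_eq]
  refine tsum_congr fun ζ => congrArg (fun δ' => f (E ζ).1 * g δ') ?_
  have h1 := Mor.mul_inv_inv_mul γ.1 ζ.1 (γ.2.trans ζ.2.symm)
  have h2 := Mor.mul_assoc (Mor.mul γ.1 ζ.1.inv (γ.2.trans ζ.2.symm)).inv γ.1 θ.1.inv rfl
    (γ.2.trans θ.2.symm)
  refine h2.symm.trans ?_
  congr 1

end Regular
section ReducedCStarAlgebra
variable (X : Type u) [Groupoid.{v} X]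

/-- The C*-algebra `∏_x B(ℓ²(Gx))` of bounded families of operators, with the supremum norm. -/
def RegularProduct : Type (max u v) :=
  lp (fun x : X => ℓ²(Fiber x, ℂ) →L[ℂ] ℓ²(Fiber x, ℂ)) ∞

instance : NonUnitalCStarAlgebra (RegularProduct X) :=
  inferInstanceAs
    (NonUnitalCStarAlgebra (lp (fun x : X => ℓ²(Fiber x, ℂ) →L[ℂ] ℓ²(Fiber x, ℂ)) ∞))

variable {X} in
/-- The component at `x` of an element of the product. -/
def RegularProduct.component (T : RegularProduct X) (x : X) :
    ℓ²(Fiber x, ℂ) →L[ℂ] ℓ²(Fiber x, ℂ) :=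
  T.1 x

variable {X} in
/-- A bounded family of operators, as an element of the product. -/
def RegularProduct.mk (T : ∀ x : X, ℓ²(Fiber x, ℂ) →L[ℂ] ℓ²(Fiber x, ℂ))
    (h : ∃ C, ∀ x, ‖T x‖ ≤ C) : RegularProduct X :=
  ⟨T, memℓp_infty (h.imp fun C hC => by rintro _ ⟨x, rfl⟩; exact hC x)⟩

variable {X} in
theorem RegularProduct.ext {S T : RegularProduct X} (h : ∀ x, S.component x = T.component x) :
    S = T :=
  Subtype.ext (funext h)

variable {X} in
theorem RegularProduct.norm_eq (T : RegularProduct X) : ‖T‖ = ⨆ x, ‖T.component x‖ :=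
  lp.norm_eq_ciSup _

variable {X} in
theorem RegularProduct.norm_le {T : RegularProduct X} {C : ℝ} (hC : 0 ≤ C)
    (h : ∀ x, ‖T.component x‖ ≤ C) : ‖T‖ ≤ C :=
  lp.norm_le_of_forall_le hC h

variable [TopologicalSpace X] [TopologicalSpace (Mor X)] [IsEtaleGroupoid X]

/-- The direct sum `π = (π_x)_x` of the regular representations. Its norm is the reduced norm
`‖f‖_r = sup_x ‖π_x(f)‖`. -/
def regularSum : C_c(Mor X, ℂ) →ₗ[ℂ] RegularProduct X where
  toFun f := .mk (fun x => regularRep x f) (exists_norm_regularRep_le f)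
  map_add' f g := by
    classical
    refine RegularProduct.ext fun x => op_ext fun γ ζ => ?_
    change regularRep x (f + g) (lp.single 2 ζ 1) γ =
      regularRep x f (lp.single 2 ζ 1) γ + regularRep x g (lp.single 2 ζ 1) γ
    simp only [regularRep_single]
    rfl
  map_smul' c f := by
    classical
    refine RegularProduct.ext fun x => op_ext fun γ ζ => ?_
    change regularRep x (c • f) (lp.single 2 ζ 1) γ = c • regularRep x f (lp.single 2 ζ 1) γ
    simp only [regularRep_single]
    rfl

theorem norm_regularSum (f : C_c(Mor X, ℂ)) : ‖regularSum X f‖ = ⨆ x, ‖regularRep x f‖ :=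
  RegularProduct.norm_eq _

variable [T2Space (Mor X)] [LocallyCompactSpace (Mor X)]

/-- The image of the convolution algebra `C_c(G)` under `π`. -/
def regularImage : NonUnitalStarSubalgebra ℂ (RegularProduct X) where
  carrier := Set.range (regularSum X)
  add_mem' := by
    rintro _ _ ⟨f, rfl⟩ ⟨g, rfl⟩
    exact ⟨f + g, map_add _ f g⟩
  zero_mem' := ⟨0, map_zero _⟩
  smul_mem' := by
    rintro c _ ⟨f, rfl⟩
    exact ⟨c • f, map_smul _ c f⟩
  mul_mem' := by
    rintro _ _ ⟨f, rfl⟩ ⟨g, rfl⟩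
    exact ⟨convolution f g, RegularProduct.ext fun x => regularRep_convolution x f g⟩
  star_mem' := by
    rintro _ ⟨f, rfl⟩
    exact ⟨involution f, RegularProduct.ext fun x => regularRep_involution x f⟩

/-- The reduced groupoid C*-algebra `C*_r(G)`: the completion of the convolution algebra `C_c(G)`
in the reduced norm, realised as the norm closure of its image under the (faithful) direct sum of
the regular representations. -/
def reducedCStarAlgebra : NonUnitalStarSubalgebra ℂ (RegularProduct X) :=
  (regularImage X).topologicalClosure

instance : IsClosed (reducedCStarAlgebra X : Set (RegularProduct X)) :=
  NonUnitalStarSubalgebra.isClosed_topologicalClosure _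

/-- The extension of a function in `C_c(G⁰)` to `G` by zero. -/
def extendByZero (f : C_c(X, ℂ)) : C_c(Mor X, ℂ) where
  toFun := open scoped Classical in fun γ =>
    if γ ∈ Set.range (Mor.one : X → Mor X) then f γ.src else 0
  continuous_toFun := by
    classical
    have hcl : IsClopen (Set.range (Mor.one : X → Mor X)) :=
      ⟨isClosed_range_one, isOpenEmbedding_one.isOpen_range⟩
    refine Continuous.if (fun γ hγ => ?_) (f.continuous.comp continuous_src) continuous_const
    have : frontier {γ : Mor X | γ ∈ Set.range (Mor.one : X → Mor X)} = ∅ := hcl.frontier_eq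
    rw [this] at hγ
    exact hγ.elim
  hasCompactSupport' := by
    refine HasCompactSupport.intro
      (f.hasCompactSupport.isCompact.image (isOpenEmbedding_one (X := X)).continuous) fun γ hγ => ?_
    split_ifs with h
    · obtain ⟨x, rfl⟩ := h
      by_contra hne
      exact hγ ⟨x, subset_closure hne, rfl⟩
    · rfl

variable {X}

open scoped Classical in
/-- The matrix of multiplication by `f ∘ r` on `ℓ²(Gx)`. -/
def unitKernel (f : X → ℂ) (x : X) (γ ζ : Fiber x) : ℂ := if γ = ζ then f γ.1.rng else 0

theorem isBanded_unitKernel {f : X → ℂ} {M : ℝ} (hM : 0 ≤ M) (hf : ∀ y, ‖f y‖ ≤ M) (x : X) :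
    IsBanded (unitKernel f x) 1 M where
  nonneg := hM
  norm_le γ ζ := by
    unfold unitKernel
    split_ifs
    · exact hf _
    · simpa using hM
  row γ := by
    refine (Set.encard_le_encard (t := {γ}) fun ζ hζ => ?_).trans (by simp)
    by_contra h
    exact hζ (if_neg fun h' => h h'.symm)
  col ζ := by
    refine (Set.encard_le_encard (t := {ζ}) fun γ hγ => ?_).trans (by simp)
    by_contra h
    exact hγ (if_neg h)

theorem norm_apply_le (f : C₀(X, ℂ)) (y : X) : ‖f y‖ ≤ ‖f‖ := f.toBCF.norm_coe_le_norm y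

/-- The operator of multiplication by `f ∘ r` on `ℓ²(Gx)`, the extension of `π_x` to
`f ∈ C_0(G⁰)`. -/
def unitOp (x : X) (f : C₀(X, ℂ)) : ℓ²(Fiber x, ℂ) →L[ℂ] ℓ²(Fiber x, ℂ) :=
  kernelOp (unitKernel f x)
    ⟨1, ‖f‖, isBanded_unitKernel (norm_nonneg f) (norm_apply_le f) x⟩

theorem unitOp_apply (x : X) (f : C₀(X, ℂ)) (ξ : ℓ²(Fiber x, ℂ)) (γ : Fiber x) :
    unitOp x f ξ γ = f γ.1.rng * ξ γ := by
  refine (tsum_eq_single γ fun ζ hζ => ?_).trans ?_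
  · rw [unitKernel, if_neg hζ.symm, zero_mul]
  · rw [unitKernel, if_pos rfl]

theorem norm_unitOp_le (x : X) (f : C₀(X, ℂ)) : ‖unitOp x f‖ ≤ ‖f‖ := by
  have := norm_kernelOp_le (isBanded_unitKernel (norm_nonneg f) (norm_apply_le f) x)
  rwa [Nat.cast_one, one_mul] at this

/-- The family of multiplication operators of `f ∈ C_0(G⁰)`. -/
def unitFamily (f : C₀(X, ℂ)) : RegularProduct X :=
  .mk (fun x => unitOp x f) ⟨‖f‖, fun x => norm_unitOp_le x f⟩

theorem norm_unitFamily_le (f : C₀(X, ℂ)) : ‖unitFamily f‖ ≤ ‖f‖ :=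
  RegularProduct.norm_le (norm_nonneg f) fun x => norm_unitOp_le x f

theorem unitFamily_sub (f g : C₀(X, ℂ)) : unitFamily (f - g) = unitFamily f - unitFamily g := by
  refine RegularProduct.ext fun x => ?_
  ext ξ γ
  change unitOp x (f - g) ξ γ = unitOp x f ξ γ - unitOp x g ξ γ
  simp only [unitOp_apply]
  exact sub_mul _ _ _

/-- On `C_c(G⁰)` the multiplication operators are the image under `π` of the extension by zero. -/
theorem unitFamily_eq (f : C₀(X, ℂ)) (g : C_c(X, ℂ)) (h : ∀ x, f x = g x) :
    unitFamily f = regularSum X (extendByZero X g) := by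
  classical
  refine RegularProduct.ext fun x => op_ext fun γ ζ => ?_
  change unitOp x f (lp.single 2 ζ 1) γ = regularRep x (extendByZero X g) (lp.single 2 ζ 1) γ
  rw [regularRep_single, unitOp, kernelOp_single, unitKernel]
  change _ = if _ then _ else _
  by_cases hγ : γ = ζ
  · subst hγ
    rw [if_pos rfl, if_pos ⟨γ.1.rng, (Mor.mul_inv_self γ.1).symm⟩]
    exact h _
  · rw [if_neg hγ, if_neg]
    rintro ⟨y, hy⟩
    exact hγ (Subtype.ext (Mor.mul_inv_eq_one _ hy.symm))

theorem exists_approx (f : C₀(X, ℂ)) {ε : ℝ} (hε : 0 < ε) :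
    ∃ g : C_c(X, ℂ), ∀ x, ‖f x - g x‖ ≤ ε := by
  have := t2Space_unit (X := X)
  have hpos : ∀ x, 0 < max ‖f x‖ ε := fun x => lt_max_of_lt_right hε
  have hev : ∀ᶠ x in cocompact X, ‖f x‖ < ε := by
    have := (zero_at_infty f).norm
    rw [norm_zero] at this
    exact this.eventually (gt_mem_nhds hε)
  obtain ⟨K, hK, hKf⟩ := mem_cocompact.1 hev
  refine ⟨⟨⟨fun x => f x * ((1 - ε / max ‖f x‖ ε : ℝ) : ℂ), ?_⟩, ?_⟩, fun x => ?_⟩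
  · refine (map_continuous f).mul (Complex.continuous_ofReal.comp (continuous_const.sub
      (continuous_const.div ((map_continuous f).norm.max continuous_const) fun x => (hpos x).ne')))
  · refine HasCompactSupport.intro hK fun x hx => ?_
    have : ‖f x‖ < ε := hKf hx
    simp [max_eq_right this.le, hε.ne']
  · change ‖f x - f x * ((1 - ε / max ‖f x‖ ε : ℝ) : ℂ)‖ ≤ ε
    have : f x - f x * ((1 - ε / max ‖f x‖ ε : ℝ) : ℂ) = f x * ((ε / max ‖f x‖ ε : ℝ) : ℂ) := by
      push_cast; ring
    rw [this, norm_mul, Complex.norm_real, Real.norm_of_nonneg (by have := hpos x; positivity),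
      ← mul_div_assoc, div_le_iff₀ (hpos x), mul_comm]
    gcongr
    exact le_max_left _ _

theorem unitFamily_mem (f : C₀(X, ℂ)) : unitFamily f ∈ reducedCStarAlgebra X := by
  refine Metric.mem_closure_iff.2 fun ε hε => ?_
  obtain ⟨g, hg⟩ := exists_approx f (half_pos hε)
  have hg0 : Tendsto g (cocompact X) (𝓝 0) := by
    refine tendsto_const_nhds.congr' ?_
    filter_upwards [g.hasCompactSupport.isCompact.compl_mem_cocompact] with x hx
    exact (image_eq_zero_of_notMem_tsupport hx).symm
  let g₀ : C₀(X, ℂ) := ⟨g.toContinuousMap, hg0⟩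
  refine ⟨regularSum X (extendByZero X g), ⟨_, rfl⟩, ?_⟩
  rw [← unitFamily_eq g₀ g fun _ => rfl, dist_eq_norm, ← unitFamily_sub]
  refine (norm_unitFamily_le _).trans_lt (lt_of_le_of_lt ?_ (half_lt_self hε))
  exact (BoundedContinuousFunction.norm_le (half_pos hε).le).2 hg

variable (X)

/-- The embedding of `C_0(G⁰)` into `C*_r(G)` that extends the map `C_c(G⁰) → C_c(G)`
(extension by zero). -/
def unitEmbedding : C₀(X, ℂ) →⋆ₙₐ[ℂ] reducedCStarAlgebra X where
  toFun f := ⟨unitFamily f, unitFamily_mem f⟩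
  map_smul' c f := by
    refine Subtype.ext (RegularProduct.ext fun x => ?_)
    ext ξ γ
    change unitOp x (c • f) ξ γ = c • unitOp x f ξ γ
    simp only [unitOp_apply]
    exact smul_mul_assoc c (f γ.1.rng) (ξ γ)
  map_zero' := by
    refine Subtype.ext (RegularProduct.ext fun x => ?_)
    ext ξ γ
    change unitOp x 0 ξ γ = 0
    rw [unitOp_apply]
    exact zero_mul _
  map_add' f g := by
    refine Subtype.ext (RegularProduct.ext fun x => ?_)
    ext ξ γ
    change unitOp x (f + g) ξ γ = unitOp x f ξ γ + unitOp x g ξ γ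
    simp only [unitOp_apply]
    exact add_mul _ _ _
  map_mul' f g := by
    refine Subtype.ext (RegularProduct.ext fun x => ?_)
    ext ξ γ
    change unitOp x (f * g) ξ γ = unitOp x f (unitOp x g ξ) γ
    simp only [unitOp_apply]
    exact mul_assoc _ _ _
  map_star' f := by
    classical
    refine Subtype.ext (RegularProduct.ext fun x => op_ext fun γ ζ => ?_)
    change unitOp x (star f) (lp.single 2 ζ 1) γ = (star (unitOp x f)) (lp.single 2 ζ 1) γ
    rw [adjoint_single, unitOp_apply, unitOp_apply]
    change star (f _) * _ = _
    by_cases h : γ = ζ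
    · subst h
      simp
    · simp [lp.single_apply, h, Ne.symm h]

end ReducedCStarAlgebra
section PurelyInfinite
variable {A : Type*} [NonUnitalCStarAlgebra A]

/-- Positive elements of a C*-algebra. -/
def IsPositive (a : A) : Prop := ∃ x : A, a = star x * x

/-- Cuntz comparison of positive elements: `a ≾ b` if `x_k* b x_k → a` for some sequence `x_k`. -/
def CuntzBelow (a b : A) : Prop :=
  ∃ x : ℕ → A, Tendsto (fun k => star (x k) * b * x k) atTop (𝓝 a)

/-- The closed two-sided ideal `\overline{AbA}`, the closed linear span of the products `x b y`. -/
def closedIdeal (b : A) : Set A :=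
  closure (Submodule.span ℂ {z : A | ∃ x y : A, z = x * b * y} : Set A)

variable (A) in
/-- Purely infinite C*-algebras, in the sense of Kirchberg and Rørdam: there are no characters, and
for positive `a`, `b` one has `a ≾ b` if and only if `a` lies in the closed ideal of `b`. -/
def IsPurelyInfinite : Prop :=
  IsEmpty (WeakDual.characterSpace ℂ A) ∧
    ∀ a b : A, IsPositive a → IsPositive b → (CuntzBelow a b ↔ a ∈ closedIdeal b)

/-- Infinite projections: projections that are Murray-von Neumann equivalent to a proper
subprojection of themselves. -/
def IsInfiniteProjection (p : A) : Prop :=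
  IsStarProjection p ∧
    ∃ s : A, star s * s = p ∧ p * (s * star s) = s * star s ∧ s * star s ≠ p

end PurelyInfinite

end EtaleGroupoid

end

/-! Write `1_U` for the projection of a compact open set `U` of units. Two facts drive both
directions. By topological principality, every nonzero positive `b` dominates some basic `1_V`, in
the exact form `z* b z = 1_V` (`exists_unit_below`): approximate `b` by a compactly supported `f`,
move to a unit with trivial isotropy, and shrink `V` around it until `1_V f 1_V` is nearly a
positive constant on `V`. By minimality and compactness, every `1_U` is a finite sum of terms `v 1_W
v*` for any nonempty `W` (`exists_list_sum_eq`).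

Suppose the basic projections are infinite. If `s* s = q` and `s s* < q`, the gap `q - s s*`
dominates some `1_W`, and the powers of `s` provide infinitely many orthogonal copies of the gap
under `q`. Hence `q` absorbs the whole sum of the `v 1_W v*`, that is, it dominates every `1_U`
(`exists_star_mul_self_eq_unit`). Since the `1_U` act as local units on `C_c(G)`, every positive
element lies below every nonzero positive `b`. A character vanishes on the gap, hence on some `1_W`,
hence on everything.

Conversely, suppose the algebra is purely infinite. If `U` has two points, it has a proper nonempty
compact open subset `V`. Then `1_U` lies in the ideal of `1_V`, so `1_U ≾ 1_V`, which makes `1_U`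
infinite. If `U` is a single point, the corner at `1_U` is `ℂ`. Then either the whole algebra is
`ℂ`, which has a character, or the ideal of `1_U` contains a sum of two equivalent orthogonal
minimal projections, which is not below `1_U`. -/

namespace EtaleGroupoid

/-! ### Cuntz comparison with projections in a C*-algebra. -/

section CStarAlgebra
variable {A : Type*} [NonUnitalCStarAlgebra A]

/-- An element of the corner `pAp` close to its unit `p` is positive and invertible there, and `c`
is its inverse square root. The functional calculus is carried out in the unitization. -/
theorem exists_star_mul_mul_eq_of_corner {p a : A} (hp : IsStarProjection p)
    (ha : IsSelfAdjoint a) (hpa : p * a = a) (h : ‖a - p‖ < 1) :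
    ∃ c : A, star c * a * c = p := by
  have hap : a * p = a := by
    simpa [ha.star_eq, hp.isSelfAdjoint.star_eq] using congrArg star hpa
  set P : Unitization ℂ A := (p : Unitization ℂ A) with hP
  set a' : Unitization ℂ A := (a : Unitization ℂ A) with ha'
  have hPP : P * P = P := by
    rw [hP, ← Unitization.inr_mul, hp.isIdempotentElem.eq]
  have hPa : P * a' = a' := by rw [hP, ha', ← Unitization.inr_mul, hpa]
  have haP : a' * P = a' := by rw [hP, ha', ← Unitization.inr_mul, hap]
  have hPs : star P = P := by rw [hP, ← Unitization.inr_star, hp.isSelfAdjoint.star_eq]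
  have has : star a' = a' := by rw [ha', ← Unitization.inr_star, ha.star_eq]
  -- Filling up with `1 - P` turns invertibility in the corner into invertibility in the
  -- unitization: `w` is within distance less than 1 of `1`, so its spectrum is positive.
  set w : Unitization ℂ A := a' + (1 - P) with hw
  have hws : IsSelfAdjoint w := by
    rw [IsSelfAdjoint, hw]; simp [hPs, has]
  have hw1 : ‖w - 1‖ < 1 := by
    have : w - 1 = ((a - p : A) : Unitization ℂ A) := by
      rw [Unitization.inr_sub, hw]; abel
    rwa [this, Unitization.norm_inr]
  have hwP : w * P = a' := by rw [hw, add_mul, sub_mul, haP, hPP]; simp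
  have hPw : P * w = a' := by rw [hw, mul_add, mul_sub, hPa, hPP]; simp
  have hcomm : Commute w P := hwP.trans hPw.symm
  have hspec : ∀ t ∈ spectrum ℝ w, 0 < t := by
    intro t ht
    have h1 : t - 1 ∈ spectrum ℝ (w - 1) := by
      have := spectrum.sub_singleton_eq (R := ℝ) w 1
      rw [map_one] at this
      rw [← this]
      exact Set.sub_mem_sub ht rfl
    have h2 := (spectrum.norm_le_norm_of_mem h1).trans_lt hw1
    rw [Real.norm_eq_abs, abs_lt] at h2
    linarith
  set g : ℝ → ℝ := fun t => (√t)⁻¹ with hg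
  have hgc : ContinuousOn g (spectrum ℝ w) :=
    Real.continuous_sqrt.continuousOn.inv₀ fun t ht => (Real.sqrt_pos.2 (hspec t ht)).ne'
  set c := cfc g w with hc
  have hcs : star c = c := (cfc_predicate g w : IsSelfAdjoint c).star_eq
  have hcP : Commute c P := hcomm.cfc_real g
  have hcwc : c * w * c = 1 := by
    have hid : cfc (fun t : ℝ => t) w = w := cfc_id' ℝ w
    have e1 : c * w = cfc (fun t => g t * t) w := by
      rw [cfc_mul g (fun t => t) w hgc continuousOn_id, hid]
    rw [e1, hc, ← cfc_mul (fun t => g t * t) g w (hgc.mul continuousOn_id) hgc, ← cfc_one ℝ w]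
    refine cfc_congr fun t ht => ?_
    have := Real.sqrt_pos.2 (hspec t ht)
    have h2 := Real.mul_self_sqrt (hspec t ht).le
    simp only [hg, Pi.one_apply]
    field_simp
    nlinarith
  -- `A` is an ideal of its unitization, so `c * P` comes back to `A`.
  have hz : c * P = (((c * P).snd : A) : Unitization ℂ A) := by
    ext <;> simp [hP]
  refine ⟨(c * P).snd, Unitization.inr_injective (R := ℂ) ?_⟩
  rw [Unitization.inr_mul, Unitization.inr_mul, Unitization.inr_star, ← hz, star_mul, hcs, hPs]
  calc P * c * a' * (c * P) = P * c * (w * P) * (c * P) := by rw [hwP]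
    _ = P * (c * w) * (P * c) * P := by simp only [mul_assoc]
    _ = P * (c * w * c) * (P * P) := by rw [← hcP.eq]; simp only [mul_assoc]
    _ = P := by rw [hcwc, mul_one, hPP, hPP]

theorem exists_star_mul_mul_eq {p b x : A} (hp : IsStarProjection p) (hb : IsSelfAdjoint b)
    (h : ‖p * (star x * b * x) * p - p‖ < 1) : ∃ z : A, star z * b * z = p := by
  obtain ⟨c, hc⟩ := exists_star_mul_mul_eq_of_corner hp (a := p * (star x * b * x) * p)
    (by simp [IsSelfAdjoint, mul_assoc, hp.isSelfAdjoint.star_eq, hb.star_eq])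
    (by simp only [← mul_assoc, hp.isIdempotentElem.eq]) h
  refine ⟨x * p * c, Eq.trans ?_ hc⟩
  simp only [star_mul, hp.isSelfAdjoint.star_eq, mul_assoc]

/-- Below a projection, approximate comparison becomes exact, since one term of the sequence close
enough to `p` can be corrected inside the corner. -/
theorem CuntzBelow.exists_eq {p b : A} (h : CuntzBelow p b) (hp : IsStarProjection p)
    (hb : IsSelfAdjoint b) : ∃ z : A, star z * b * z = p := by
  obtain ⟨x, hx⟩ := h
  have h1 : Tendsto (fun k => p * (star (x k) * b * x k) * p) atTop (𝓝 p) := by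
    have := (hx.const_mul p).mul_const p
    rwa [hp.isIdempotentElem.eq, hp.isIdempotentElem.eq] at this
  obtain ⟨k, hk⟩ := (h1.eventually (Metric.ball_mem_nhds p one_pos)).exists
  rw [dist_eq_norm] at hk
  exact exists_star_mul_mul_eq hp hb hk

/-- Composes two dominations, of `q` by `b` and of `u` by `q`, with a local unit `u` of `f`. -/
theorem star_mul_mul_mul_eq {b q u y z f : A} (hz : star z * b * z = q) (hqy : q * y = y)
    (hy : star y * y = u) (hf : u * f = f) :
    star (z * (y * f)) * b * (z * (y * f)) = star f * f := by
  calc _ = star f * ((star y * ((star z * b * z) * y)) * f) := by simp only [star_mul, mul_assoc]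
    _ = _ := by rw [hz, hqy, hy, hf]

theorem cuntzBelow_of_forall_exists {a b : A}
    (h : ∀ ε > 0, ∃ x : A, ‖star x * b * x - a‖ < ε) : CuntzBelow a b := by
  choose! x hx using h
  refine ⟨fun k => x (1 / ((k : ℝ) + 1)), tendsto_iff_norm_sub_tendsto_zero.2 ?_⟩
  exact squeeze_zero (fun _ => norm_nonneg _) (fun k => (hx _ (by positivity)).le)
    tendsto_one_div_add_atTop_nhds_zero_nat

/-- By continuity of `d ↦ d* d`, it is enough to reach `f* f` exactly for `f` arbitrarily close to
`c`. This allows `c` to be replaced by compactly supported functions. -/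
theorem cuntzBelow_star_mul_self_of_approx {b c : A}
    (h : ∀ ε > 0, ∃ f : A, ‖c - f‖ < ε ∧ ∃ x : A, star x * b * x = star f * f) :
    CuntzBelow (star c * c) b := by
  refine cuntzBelow_of_forall_exists fun ε hε => ?_
  have hcont : Continuous fun d : A => star d * d := continuous_star.mul continuous_id
  obtain ⟨δ, hδ, hcδ⟩ := Metric.continuousAt_iff.1 (hcont.continuousAt (x := c)) ε hε
  obtain ⟨f, hf, x, hx⟩ := h δ hδ
  refine ⟨x, ?_⟩
  rw [hx, ← dist_eq_norm]
  exact hcδ (by rwa [dist_comm, dist_eq_norm])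

theorem CuntzBelow.mem_closedIdeal {a b : A} (h : CuntzBelow a b) : a ∈ closedIdeal b := by
  obtain ⟨x, hx⟩ := h
  exact mem_closure_of_tendsto hx
    (Eventually.of_forall fun k => Submodule.subset_span ⟨star (x k), x k, rfl⟩)

theorem cuntzBelow_zero_of_mem_closedIdeal_zero {a : A} (ha : a ∈ closedIdeal (0 : A)) :
    CuntzBelow a 0 := by
  have : {z : A | ∃ x y : A, z = x * 0 * y} = {0} := by
    ext z; simp
  rw [closedIdeal, this, Submodule.span_zero_singleton] at ha
  obtain rfl : a = 0 := by simpa using ha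
  exact ⟨0, by simp⟩

theorem IsPositive.isSelfAdjoint {a : A} (h : IsPositive a) : IsSelfAdjoint a := by
  obtain ⟨x, rfl⟩ := h
  exact .star_mul_self x

theorem _root_.IsStarProjection.isPositive {p : A} (h : IsStarProjection p) : IsPositive p :=
  ⟨p, by rw [h.isSelfAdjoint.star_eq, h.isIdempotentElem.eq]⟩

theorem mul_eq_self_of_star_mul_self_eq {q s : A} (hq : IsStarProjection q)
    (hs : star s * s = q) : s * q = s := by
  have hq1 := hq.isSelfAdjoint.star_eq
  have hq2 := hq.isIdempotentElem.eq
  refine sub_eq_zero.1 (CStarRing.star_mul_self_eq_zero_iff _ |>.1 ?_)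
  rw [star_sub, star_mul, hq1]
  simp only [sub_mul, mul_sub, mul_assoc, hs, hq2]
  rw [← mul_assoc (star s), hs, hq2, hq2]
  simp

theorem IsPositive.sub_mul_star {q s : A} (hq : IsStarProjection q) (hs : star s * s = q)
    (hqs : q * (s * star s) = s * star s) : IsPositive (q - s * star s) := by
  refine ⟨q - s * star s, ?_⟩
  have hq1 := hq.isSelfAdjoint.star_eq
  have h1 : s * star s * q = s * star s := by
    simpa only [star_mul, star_star, hq1] using congrArg star hqs
  have h2 : s * star s * (s * star s) = s * star s := by
    rw [mul_assoc, ← mul_assoc (star s), hs, ← mul_assoc, mul_eq_self_of_star_mul_self_eq hq hs]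
  simp only [star_sub, star_mul, star_star, hq1, sub_mul, mul_sub, hq.isIdempotentElem.eq, hqs, h1,
    h2]
  abel

/-- Rescaling by `t^(-1/2)` moves `q b q` from near `t q` to near `q`. -/
theorem exists_star_mul_mul_eq_of_norm_sub_lt {q b : A} {t : ℝ} (hq : IsStarProjection q)
    (hb : IsSelfAdjoint b) (ht : 0 < t) (h : ‖q * b * q - (t : ℂ) • q‖ < t) :
    ∃ z : A, star z * b * z = q := by
  set r : ℂ := (((√t)⁻¹ : ℝ) : ℂ) with hr
  have hrr : r * r * t = 1 := by
    rw [hr]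
    norm_cast
    rw [← mul_inv, Real.mul_self_sqrt ht.le, inv_mul_cancel₀ ht.ne']
  have hrs : star r = r := Complex.conj_ofReal _
  have hqq := hq.isIdempotentElem.eq
  refine exists_star_mul_mul_eq (x := r • q) hq hb ?_
  have e1 : q * (star (r • q) * b * (r • q)) * q = (r * r) • (q * b * q) := by
    simp only [star_smul, hrs, hq.isSelfAdjoint.star_eq, smul_mul_assoc, mul_smul_comm, smul_smul]
    congr 1
    simp only [← mul_assoc, hqq]
    rw [mul_assoc _ q q, hqq]
  have e : q * (star (r • q) * b * (r • q)) * q - q = (r * r) • (q * b * q - (t : ℂ) • q) := by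
    rw [e1, smul_sub, smul_smul, hrr, one_smul]
  rw [e, norm_smul]
  have hn : ‖r * r‖ * t = 1 := by
    have := congrArg norm hrr
    rwa [norm_mul (r * r), norm_one, Complex.norm_real, Real.norm_of_nonneg ht.le] at this
  have hpos : 0 < ‖r * r‖ := by
    by_contra! h0
    nlinarith [norm_nonneg (r * r)]
  calc _ < ‖r * r‖ * t := by gcongr
    _ = 1 := hn

/-- If `z* q z = p`, then `s = q z` satisfies `s* s = p` while its range stays under `q`. Were `s s*
= p`, then `q p = p` and so `q = p`. -/
theorem isInfiniteProjection_of_cuntzBelow {p q : A} (hp : IsStarProjection p)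
    (hq : IsStarProjection q) (hpq : p * q = q) (hne : q ≠ p) (h : CuntzBelow p q) :
    IsInfiniteProjection p := by
  obtain ⟨z, hz⟩ := h.exists_eq hp hq.isSelfAdjoint
  have hqs := hq.isSelfAdjoint.star_eq
  have hqq : ∀ y, q * (q * y) = q * y := fun y => by rw [← mul_assoc, hq.isIdempotentElem.eq]
  refine ⟨hp, q * z, ?_, ?_, fun h' => hne ?_⟩
  · simp only [star_mul, hqs, mul_assoc, hqq]
    rw [← mul_assoc, hz]
  · simp only [← mul_assoc, hpq]
  · have h1 : q * p = p := by
      rw [← h']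
      simp only [mul_assoc, hqq]
    have h2 := congrArg star hpq
    rw [star_mul, hqs, hp.isSelfAdjoint.star_eq, h1] at h2
    exact h2.symm

/-- If `s` implements a Murray-von Neumann equivalence of `q` with a proper subprojection, then any
finite sum of elements `v w v*` is dominated by `q`, provided `w` is dominated by the gap. -/
theorem exists_star_mul_self_eq_list_sum {q s z w : A} (hq : IsStarProjection q)
    (hs : star s * s = q) (hqs : q * (s * star s) = s * star s)
    (hz : star z * (q - s * star s) * z = w) (L : List A) :
    ∃ y : A, q * y = y ∧ star y * y = (L.map fun v => v * w * star v).sum := by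
  have hq1 := hq.isSelfAdjoint.star_eq
  have hq2 := hq.isIdempotentElem.eq
  have hsq : s * q = s := mul_eq_self_of_star_mul_self_eq hq hs
  have hqs' : q * s = s := by
    calc q * s = q * (s * star s) * s := by rw [mul_assoc, mul_assoc, hs, hsq]
      _ = s := by rw [hqs, mul_assoc, hs, hsq]
  set d := q - s * star s with hd
  have hds : star d = d := by simp [hd, hq1]
  have hd1 : d * s = 0 := by rw [hd, sub_mul, hqs', mul_assoc, hs, hsq, sub_self]
  have hd2 : star s * d = 0 := by simpa [hds] using congrArg star hd1
  have hqd : q * d = d := by rw [hd, mul_sub, hq2, hqs]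
  have hdd : d * d = d := by
    conv_lhs => rw [hd, sub_mul, ← hd, hqd, mul_assoc, hd2, mul_zero, sub_zero]
  induction L with
  | nil => exact ⟨0, by simp⟩
  | cons v L ih =>
    obtain ⟨y, hy1, hy2⟩ := ih
    -- Applying `s` pushes the earlier terms into `s s*` and frees the gap `d` for the new one. As
    -- `d` is a projection orthogonal to the range of `s`, the cross terms vanish.
    refine ⟨s * y + d * (z * star v), ?_, ?_⟩
    · rw [mul_add, ← mul_assoc, hqs', ← mul_assoc q d, hqd]
    · rw [List.map_cons, List.sum_cons, ← hy2, ← hz]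
      have e1 : ∀ t, star s * (s * t) = q * t := fun t => by rw [← mul_assoc, hs]
      have e2 : ∀ t, star s * (d * t) = 0 := fun t => by rw [← mul_assoc, hd2, zero_mul]
      have e3 : ∀ t, d * (s * t) = 0 := fun t => by rw [← mul_assoc, hd1, zero_mul]
      have e4 : ∀ t, d * (d * t) = d * t := fun t => by rw [← mul_assoc, hdd]
      simp only [star_add, star_mul, star_star, add_mul, mul_add, mul_assoc, hds, e1, e2, e3, e4,
        hy1, mul_zero, add_zero, zero_add]
      abel

/-- `p + u* u` behaves like a 2×2 identity matrix, while each `x* p x` compresses to a matrix of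
rank at most one with entries such as `|α|²`, `|β|²` and `conj α · β`. The limit of matrices with
determinant zero cannot be the identity. -/
theorem not_cuntzBelow_of_minimal {p u : A} (hp : IsStarProjection p) (hp0 : p ≠ 0)
    (hmin : ∀ a : A, ∃ α : ℂ, p * a * p = α • p) (hu : u * star u = p) (hup : u * p = 0) :
    ¬ CuntzBelow (p + star u * u) p := by
  rintro ⟨x, hx⟩
  have hps := hp.isSelfAdjoint.star_eq
  have hpp := hp.isIdempotentElem.eq
  have hus : star u * p = star u :=
    mul_eq_self_of_star_mul_self_eq hp (by rw [star_star, hu])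
  have hpu : p * u = u := by simpa [hps] using congrArg star hus
  have hpus : p * star u = 0 := by simpa [hps] using congrArg star hup
  choose α hα using fun k => hmin (x k)
  choose β hβ using fun k => hmin (x k * star u)
  have hβ' : ∀ k, p * (x k * star u) = β k • p := fun k => by
    rw [← hβ, mul_assoc, mul_assoc, hus]
  have hα' : ∀ k, p * star (x k) * p = star (α k) • p := fun k => by
    simpa [hps, mul_assoc] using congrArg star (hα k)
  have hβs : ∀ k, u * star (x k) * p = star (β k) • p := fun k => by
    simpa [hps, mul_assoc] using congrArg star (hβ' k)
  have hpn : ‖p‖ ≠ 0 := norm_ne_zero_iff.2 hp0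
  have l1 : Tendsto (fun k => (star (α k) * α k) • p) atTop (𝓝 p) := by
    have h1 := (hx.const_mul p).mul_const p
    have e : p * (p + star u * u) * p = p := by
      rw [mul_add, ← mul_assoc, hpus, zero_mul, add_zero, hpp, hpp]
    rw [e] at h1
    refine h1.congr fun k => ?_
    have : p * (star (x k) * p * x k) * p = (p * star (x k) * p) * (p * x k * p) := by
      simp only [← mul_assoc]; rw [mul_assoc (p * star (x k)) p p, hpp]
    rw [this, hα, hα', smul_mul_smul_comm, hpp]
  have l2 : Tendsto (fun k => (star (β k) * β k) • p) atTop (𝓝 p) := by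
    have h1 := (hx.const_mul u).mul_const (star u)
    have e : u * (p + star u * u) * star u = p := by
      rw [mul_add, ← mul_assoc, hup, zero_add, hu, hpu, hu]
    rw [e] at h1
    refine h1.congr fun k => ?_
    have : u * (star (x k) * p * x k) * star u
        = (u * star (x k) * p) * (p * (x k * star u)) := by
      simp only [← mul_assoc]; rw [mul_assoc (u * star (x k)) p p, hpp]
    rw [this, hβ', hβs, smul_mul_smul_comm, hpp]
  have l3 : Tendsto (fun k => (star (α k) * β k) • p) atTop (𝓝 0) := by
    have h1 := (hx.const_mul p).mul_const (star u)
    have e : p * (p + star u * u) * star u = 0 := by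
      rw [mul_add, hpp, ← mul_assoc, hpus, zero_mul, add_zero, hpus]
    rw [e] at h1
    refine h1.congr fun k => ?_
    have : p * (star (x k) * p * x k) * star u
        = (p * star (x k) * p) * (p * (x k * star u)) := by
      simp only [← mul_assoc]; rw [mul_assoc (p * star (x k)) p p, hpp]
    rw [this, hβ', hα', smul_mul_smul_comm, hpp]
  -- The vanishing determinant, in norms: the sequence is constantly zero but tends to `‖p‖²`.
  have n12 := (l1.norm.mul l2.norm).sub (l3.norm.mul l3.norm)
  rw [norm_zero, mul_zero, sub_zero] at n12
  refine hpn (mul_self_eq_zero.1 (tendsto_nhds_unique n12 (tendsto_const_nhds.congr fun k => ?_)))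
  simp only [norm_smul, norm_mul, norm_star]
  ring

/-- On `A = ℂ p`, a functional with value 1 at the idempotent `p` is multiplicative. -/
theorem nonempty_characterSpace_of_forall_eq_smul {p : A} (hp : IsStarProjection p) (hp0 : p ≠ 0)
    (h : ∀ a : A, ∃ α : ℂ, a = α • p) : Nonempty (WeakDual.characterSpace ℂ A) := by
  obtain ⟨φ, hφ⟩ := SeparatingDual.exists_eq_one (R := ℂ) hp0
  refine ⟨⟨(φ : WeakDual ℂ A), fun h0 => ?_, fun a b => ?_⟩⟩
  · have : φ p = 0 := congrArg (fun ψ : WeakDual ℂ A => ψ p) h0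
    exact one_ne_zero (hφ.symm.trans this)
  · obtain ⟨α, rfl⟩ := h a
    obtain ⟨β, rfl⟩ := h b
    change φ _ = φ _ * φ _
    rw [smul_mul_smul_comm, hp.isIdempotentElem.eq]
    simp [hφ]

end CStarAlgebra

end EtaleGroupoid

namespace EtaleGroupoid

open TopologicalSpace (CompactOpens)

/-! ### Indicator functions of compact open sets. -/

section Indicator
variable {Y : Type*} [TopologicalSpace Y] [T2Space Y]

theorem continuous_indicator_compactOpens (U : CompactOpens Y) {f : Y → ℂ}
    (hf : ContinuousOn f U) : Continuous (Set.indicator (U : Set Y) f) := by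
  have hU : IsClopen (U : Set Y) := ⟨U.isCompact.isClosed, U.isOpen⟩
  refine continuous_iff_continuousAt.2 fun y => ?_
  by_cases hy : y ∈ (U : Set Y)
  · refine (hf.continuousAt (hU.isOpen.mem_nhds hy)).congr ?_
    filter_upwards [hU.isOpen.mem_nhds hy] with z hz
    exact (Set.indicator_of_mem hz f).symm
  · refine continuousAt_const.congr (f := fun _ => (0 : ℂ)) ?_
    filter_upwards [hU.compl.isOpen.mem_nhds hy] with z hz
    exact (Set.indicator_of_notMem hz f).symm

/-- A function that is continuous on a compact open set, cut down to this set. -/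
noncomputable def cutoff (U : CompactOpens Y) (f : Y → ℂ) (hf : ContinuousOn f U) : C₀(Y, ℂ) where
  toFun := Set.indicator (U : Set Y) f
  continuous_toFun := continuous_indicator_compactOpens U hf
  zero_at_infty' := by
    refine tendsto_const_nhds.congr' ?_
    filter_upwards [U.isCompact.compl_mem_cocompact] with y hy
    exact (Set.indicator_of_notMem hy f).symm

/-- The indicator function of a compact open set, vanishing at infinity. -/
noncomputable def unitIndicator (U : CompactOpens Y) : C₀(Y, ℂ) :=
  cutoff U (fun _ => 1) continuousOn_const

/-- The indicator function of a compact open set, as a compactly supported function. -/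
noncomputable def indicatorCc (B : CompactOpens Y) : C_c(Y, ℂ) where
  toFun := Set.indicator (B : Set Y) fun _ => 1
  continuous_toFun := continuous_indicator_compactOpens B continuousOn_const
  hasCompactSupport' := HasCompactSupport.intro B.isCompact fun _ hy =>
    Set.indicator_of_notMem hy _

theorem cutoff_of_mem {U : CompactOpens Y} {f : Y → ℂ} (hf : ContinuousOn f U) {y : Y}
    (hy : y ∈ U) : cutoff U f hf y = f y := Set.indicator_of_mem (s := (U : Set Y)) hy f

theorem cutoff_of_notMem {U : CompactOpens Y} {f : Y → ℂ} (hf : ContinuousOn f U) {y : Y}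
    (hy : y ∉ U) : cutoff U f hf y = 0 := Set.indicator_of_notMem (s := (U : Set Y)) hy f

theorem unitIndicator_of_mem {U : CompactOpens Y} {y : Y} (hy : y ∈ U) :
    unitIndicator U y = 1 := cutoff_of_mem continuousOn_const hy

theorem unitIndicator_of_notMem {U : CompactOpens Y} {y : Y} (hy : y ∉ U) :
    unitIndicator U y = 0 := cutoff_of_notMem continuousOn_const hy

theorem indicatorCc_of_mem {B : CompactOpens Y} {y : Y} (hy : y ∈ B) :
    indicatorCc B y = 1 := Set.indicator_of_mem (s := (B : Set Y)) hy fun _ => (1 : ℂ)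

theorem indicatorCc_of_notMem {B : CompactOpens Y} {y : Y} (hy : y ∉ B) :
    indicatorCc B y = 0 := Set.indicator_of_notMem (s := (B : Set Y)) hy fun _ => (1 : ℂ)

theorem isStarProjection_unitIndicator (U : CompactOpens Y) :
    IsStarProjection (unitIndicator U) := by
  constructor
  · refine DFunLike.ext _ _ fun y => ?_
    change unitIndicator U y * unitIndicator U y = unitIndicator U y
    by_cases hy : y ∈ U
    · rw [unitIndicator_of_mem hy, mul_one]
    · rw [unitIndicator_of_notMem hy, mul_zero]
  · refine DFunLike.ext _ _ fun y => ?_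
    change star (unitIndicator U y) = unitIndicator U y
    by_cases hy : y ∈ U
    · rw [unitIndicator_of_mem hy, star_one]
    · rw [unitIndicator_of_notMem hy, star_zero]

theorem support_unitIndicator (U : CompactOpens Y) :
    Function.support (unitIndicator U) = (U : Set Y) := by
  ext y
  by_cases hy : y ∈ U
  · simpa [unitIndicator_of_mem hy] using hy
  · simpa [unitIndicator_of_notMem hy] using hy

theorem tsupport_unitIndicator (U : CompactOpens Y) :
    tsupport (unitIndicator U) = (U : Set Y) := by
  rw [tsupport, support_unitIndicator, U.isCompact.isClosed.closure_eq]

/-- An idempotent function takes only the values 0 and 1, so its support is both open and closed. -/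
theorem exists_eq_unitIndicator {p : C₀(Y, ℂ)} (hp : IsStarProjection p)
    (hc : IsCompact (tsupport p)) : ∃ U : CompactOpens Y, p = unitIndicator U := by
  have h01 : ∀ y, p y = 0 ∨ p y = 1 := fun y => by
    have : p y * p y = p y := DFunLike.congr_fun hp.isIdempotentElem.eq y
    rcases eq_or_ne (p y) 0 with h | h
    · exact .inl h
    · exact .inr (mul_left_cancel₀ h (this.trans (mul_one _).symm))
  have h0 : Function.support p = p ⁻¹' {1} := by
    ext y
    rcases h01 y with h | h <;> simp [h]
  have hcl : IsClosed (Function.support p) := h0 ▸ isClosed_singleton.preimage (map_continuous p)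
  have ho : IsOpen (Function.support p) :=
    isOpen_compl_singleton.preimage (map_continuous p)
  rw [tsupport, hcl.closure_eq] at hc
  refine ⟨⟨⟨_, hc⟩, ho⟩, DFunLike.ext _ _ fun y => ?_⟩
  rcases h01 y with h | h
  · rw [h, unitIndicator_of_notMem]
    exact fun hy => hy h
  · rw [h, unitIndicator_of_mem]
    change p y ≠ 0
    simp [h]

end Indicator

/-! ### Matrix entries in the regular representations. -/

section Entries
variable {X : Type u} [Groupoid.{v} X] [TopologicalSpace X] [TopologicalSpace (Mor X)]
  [IsEtaleGroupoid X] [T2Space (Mor X)] [LocallyCompactSpace (Mor X)]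

attribute [local instance] t2Space_unit

open scoped Classical in
/-- The matrix entries of an element of the reduced C*-algebra in the regular representations. -/
noncomputable def entry (a : reducedCStarAlgebra X) {x : X} (γ ζ : Fiber x) : ℂ :=
  a.1.component x (lp.single 2 ζ 1) γ

theorem ext_entry {a b : reducedCStarAlgebra X}
    (h : ∀ (x : X) (γ ζ : Fiber x), entry a γ ζ = entry b γ ζ) : a = b := by
  classical
  refine Subtype.ext (RegularProduct.ext fun x => op_ext fun γ ζ => ?_)
  exact h x γ ζ

theorem entry_sub (a b : reducedCStarAlgebra X) {x : X} (γ ζ : Fiber x) :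
    entry (a - b) γ ζ = entry a γ ζ - entry b γ ζ := rfl

theorem entry_zero {x : X} (γ ζ : Fiber x) : entry (0 : reducedCStarAlgebra X) γ ζ = 0 := rfl

theorem entry_star (a : reducedCStarAlgebra X) {x : X} (γ ζ : Fiber x) :
    entry (star a) γ ζ = star (entry a ζ γ) := by
  classical
  exact adjoint_single _ γ ζ

theorem norm_component_le (a : reducedCStarAlgebra X) (x : X) : ‖a.1.component x‖ ≤ ‖a‖ :=
  lp.norm_apply_le_norm ENNReal.top_ne_zero a.1 x

theorem norm_entry_le (a : reducedCStarAlgebra X) {x : X} (γ ζ : Fiber x) :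
    ‖entry a γ ζ‖ ≤ ‖a‖ := by
  classical
  refine (lp.norm_apply_le_norm two_ne_zero _ γ).trans ?_
  refine (ContinuousLinearMap.le_opNorm _ _).trans ?_
  rw [lp.norm_single (by norm_num), norm_one, mul_one]
  exact norm_component_le a x

theorem entry_unitEmbedding_mul (p : C₀(X, ℂ)) (a : reducedCStarAlgebra X) {x : X}
    (γ ζ : Fiber x) : entry (unitEmbedding X p * a) γ ζ = p γ.1.rng * entry a γ ζ :=
  unitOp_apply x p _ γ

theorem entry_mul_unitEmbedding (p : C₀(X, ℂ)) (a : reducedCStarAlgebra X) {x : X}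
    (γ ζ : Fiber x) : entry (a * unitEmbedding X p) γ ζ = entry a γ ζ * p ζ.1.rng := by
  classical
  have h : unitOp x p (lp.single 2 ζ 1) = p ζ.1.rng • lp.single 2 ζ (1 : ℂ) := by
    ext θ
    rw [unitOp_apply, lp.coeFn_smul, Pi.smul_apply, smul_eq_mul]
    by_cases hθ : θ = ζ
    · rw [hθ]
    · simp [lp.single_apply, hθ]
  change a.1.component x (unitOp x p (lp.single 2 ζ 1)) γ = _
  rw [h, map_smul, lp.coeFn_smul, Pi.smul_apply, smul_eq_mul, mul_comm]
  rfl

open scoped Classical in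
theorem entry_unitEmbedding (p : C₀(X, ℂ)) {x : X} (γ ζ : Fiber x) :
    entry (unitEmbedding X p) γ ζ = if γ = ζ then p γ.1.rng else 0 :=
  kernelOp_single ⟨1, ‖p‖, isBanded_unitKernel (norm_nonneg p) (norm_apply_le p) x⟩ γ ζ

/-- The image of a function in `C_c(G)` in the reduced C*-algebra. -/
noncomputable def ofCc (f : C_c(Mor X, ℂ)) : reducedCStarAlgebra X :=
  ⟨regularSum X f, subset_closure ⟨f, rfl⟩⟩

theorem entry_ofCc (f : C_c(Mor X, ℂ)) {x : X} (γ ζ : Fiber x) :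
    entry (ofCc f) γ ζ = f (Mor.mul γ.1 ζ.1.inv (γ.2.trans ζ.2.symm)) := by
  classical
  exact regularRep_single x f γ ζ

theorem exists_norm_sub_ofCc_lt (a : reducedCStarAlgebra X) {ε : ℝ} (hε : 0 < ε) :
    ∃ f : C_c(Mor X, ℂ), ‖a - ofCc f‖ < ε := by
  obtain ⟨_, ⟨f, rfl⟩, hf⟩ := Metric.mem_closure_iff.1 a.2 ε hε
  exact ⟨f, by rwa [dist_eq_norm] at hf⟩

theorem entry_ofCc_mul (f : C_c(Mor X, ℂ)) (b : reducedCStarAlgebra X) {x : X} (γ ζ : Fiber x) :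
    entry (ofCc f * b) γ ζ = ∑' θ, entry (ofCc f) γ θ * entry b θ ζ := by
  simp only [entry_ofCc]
  rfl

theorem norm_unitEmbedding_le (p : C₀(X, ℂ)) : ‖unitEmbedding X p‖ ≤ ‖p‖ := norm_unitFamily_le p

theorem unitEmbedding_mul_ofCc {p : C₀(X, ℂ)} {f : C_c(Mor X, ℂ)}
    (h : ∀ γ, f γ ≠ 0 → p γ.rng = 1) : unitEmbedding X p * ofCc f = ofCc f := by
  refine ext_entry fun x γ ζ => ?_
  rw [entry_unitEmbedding_mul, entry_ofCc]
  by_cases hf : f (Mor.mul γ.1 ζ.1.inv (γ.2.trans ζ.2.symm)) = 0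
  · rw [hf, mul_zero]
  · rw [show p γ.1.rng = 1 from h (Mor.mul _ _ _) hf, one_mul]

theorem ofCc_mul_unitEmbedding {p : C₀(X, ℂ)} {f : C_c(Mor X, ℂ)}
    (h : ∀ γ, f γ ≠ 0 → p γ.src = 1) : ofCc f * unitEmbedding X p = ofCc f := by
  refine ext_entry fun x γ ζ => ?_
  rw [entry_mul_unitEmbedding, entry_ofCc]
  by_cases hf : f (Mor.mul γ.1 ζ.1.inv (γ.2.trans ζ.2.symm)) = 0
  · rw [hf, zero_mul]
  · rw [show p ζ.1.rng = 1 from h (Mor.mul _ _ _) hf, mul_one]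

theorem ofCc_mul_unitEmbedding_eq_zero {p : C₀(X, ℂ)} {f : C_c(Mor X, ℂ)}
    (h : ∀ γ, f γ ≠ 0 → p γ.src = 0) : ofCc f * unitEmbedding X p = 0 := by
  refine ext_entry fun x γ ζ => ?_
  rw [entry_mul_unitEmbedding, entry_ofCc, entry_zero]
  by_cases hf : f (Mor.mul γ.1 ζ.1.inv (γ.2.trans ζ.2.symm)) = 0
  · rw [hf, zero_mul]
  · rw [show p ζ.1.rng = 0 from h (Mor.mul _ _ _) hf, mul_zero]

/-- Cutting down by a compact open set of units that avoids the support of `f` off the units. -/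
theorem unit_mul_ofCc_mul_unit {V : CompactOpens X} {f : C_c(Mor X, ℂ)}
    (h : ∀ γ, f γ ≠ 0 → γ.rng ∈ V → γ.src ∈ V → γ ∈ Set.range (Mor.one : X → Mor X))
    (hf : ContinuousOn (fun x => f (Mor.one x)) V) :
    unitEmbedding X (unitIndicator V) * ofCc f * unitEmbedding X (unitIndicator V) =
      unitEmbedding X (cutoff V (fun x => f (Mor.one x)) hf) := by
  refine ext_entry fun x γ ζ => ?_
  rw [entry_mul_unitEmbedding, entry_unitEmbedding_mul, entry_unitEmbedding, entry_ofCc]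
  split_ifs with heq
  · subst heq
    rw [Mor.mul_inv_self]
    by_cases hV : γ.1.rng ∈ V
    · rw [unitIndicator_of_mem hV, cutoff_of_mem _ hV, one_mul, mul_one]
    · rw [unitIndicator_of_notMem hV, cutoff_of_notMem _ hV, mul_zero]
  · by_cases h1 : γ.1.rng ∈ V
    swap
    · rw [unitIndicator_of_notMem h1, zero_mul, zero_mul]
    by_cases h2 : ζ.1.rng ∈ V
    swap
    · rw [unitIndicator_of_notMem h2, mul_zero]
    by_cases h0 : f (Mor.mul γ.1 ζ.1.inv (γ.2.trans ζ.2.symm)) = 0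
    · rw [h0, mul_zero, zero_mul]
    · obtain ⟨y, hy⟩ := h _ h0 h1 h2
      -- A nonzero off-diagonal entry would make `γ ζ⁻¹` a unit, forcing `γ = ζ`.
      exact (heq (Subtype.ext (Mor.mul_inv_eq_one _ hy.symm))).elim

/-- The `(γ, ζ)` entry sums `1_B(γ θ⁻¹) 1_B(ζ θ⁻¹)` over `θ`. Both arguments have source `r(θ)`, so
injectivity of the source kills the off-diagonal entries; injectivity of the range leaves at most
one `θ` on the diagonal. -/
theorem ofCc_indicator_mul_star {B : CompactOpens (Mor X)} {U : CompactOpens X}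
    (hs : Set.InjOn Mor.src (B : Set (Mor X))) (hr : Set.InjOn Mor.rng (B : Set (Mor X)))
    (hU : (U : Set X) = Mor.rng '' (B : Set (Mor X))) :
    ofCc (indicatorCc B) * star (ofCc (indicatorCc B)) = unitEmbedding X (unitIndicator U) := by
  refine ext_entry fun x γ ζ => ?_
  rw [entry_ofCc_mul, entry_unitEmbedding]
  simp only [entry_star, entry_ofCc]
  have hne : ∀ θ : Fiber x, indicatorCc B (Mor.mul γ.1 θ.1.inv (γ.2.trans θ.2.symm)) *
      star (indicatorCc B (Mor.mul ζ.1 θ.1.inv (ζ.2.trans θ.2.symm))) ≠ 0 →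
      Mor.mul γ.1 θ.1.inv (γ.2.trans θ.2.symm) ∈ B ∧
      Mor.mul ζ.1 θ.1.inv (ζ.2.trans θ.2.symm) ∈ B := by
    intro θ hθ
    constructor
    · by_contra hc
      exact hθ (by rw [indicatorCc_of_notMem hc, zero_mul])
    · by_contra hc
      exact hθ (by rw [indicatorCc_of_notMem hc, star_zero, mul_zero])
  split_ifs with heq
  · subst heq
    by_cases hV : γ.1.rng ∈ U
    · rw [unitIndicator_of_mem hV]
      have hV' : γ.1.rng ∈ (U : Set X) := hV
      rw [hU] at hV'
      obtain ⟨β, hβ, hβγ⟩ := hV'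
      have hm := Mor.mul_inv_mul_inv γ.1 β hβγ
      rw [tsum_eq_single (⟨Mor.mul β.inv γ.1 hβγ, γ.2⟩ : Fiber x)]
      · simp only [hm]
        rw [indicatorCc_of_mem (show β ∈ B from hβ)]
        simp
      · intro θ hθ
        by_contra hc
        refine hθ (Subtype.ext ?_)
        have h1 := hr (hne θ hc).1 hβ hβγ.symm
        have h2 := Mor.mul_inv_inv_mul γ.1 θ.1 (γ.2.trans θ.2.symm)
        rw [← h2]
        simp only [h1]
    · rw [unitIndicator_of_notMem hV]
      refine (tsum_congr fun θ => ?_).trans tsum_zero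
      by_contra hc
      refine hV (show γ.1.rng ∈ (U : Set X) from hU ▸ ?_)
      exact ⟨_, (hne θ hc).1, rfl⟩
  · refine (tsum_congr fun θ => ?_).trans tsum_zero
    by_contra hc
    refine heq (Subtype.ext ?_)
    have h1 := hs (hne θ hc).1 (hne θ hc).2 rfl
    have e1 := Mor.inv_mul_cancel_right γ.1 θ.1 (γ.2.trans θ.2.symm)
    have e2 := Mor.inv_mul_cancel_right ζ.1 θ.1 (ζ.2.trans θ.2.symm)
    rw [← e1, ← e2]
    congr 1

theorem isStarProjection_unitEmbedding (U : CompactOpens X) :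
    IsStarProjection (unitEmbedding X (unitIndicator U)) := by
  obtain ⟨h1, h2⟩ := isStarProjection_unitIndicator U
  exact ⟨by rw [IsIdempotentElem, ← map_mul, h1.eq], by rw [IsSelfAdjoint, ← map_star, h2.star_eq]⟩

theorem unitEmbedding_ne_zero {U : CompactOpens X} (hU : (U : Set X).Nonempty) :
    unitEmbedding X (unitIndicator U) ≠ 0 := by
  obtain ⟨x, hx⟩ := hU
  intro h
  have h1 := entry_unitEmbedding (unitIndicator U) (⟨Mor.one x, rfl⟩ : Fiber x) ⟨Mor.one x, rfl⟩
  rw [h, entry_zero, if_pos rfl, Mor.one_rng, unitIndicator_of_mem hx] at h1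
  exact zero_ne_one h1

end Entries
end EtaleGroupoid

namespace EtaleGroupoid

open TopologicalSpace (CompactOpens IsTopologicalBasis)

/-! ### Consequences of minimality and of topological principality. -/

section Ample
variable {X : Type u} [Groupoid.{v} X] [TopologicalSpace X] [TopologicalSpace (Mor X)]
  [IsAmpleGroupoid X] [T2Space (Mor X)]

attribute [local instance] t2Space_unit

theorem exists_compactOpen_bisection (γ : Mor X) {O : Set (Mor X)} (hO : IsOpen O) (hγ : γ ∈ O) :
    ∃ B : CompactOpens (Mor X), γ ∈ B ∧ (B : Set (Mor X)) ⊆ O ∧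
      Set.InjOn Mor.src (B : Set (Mor X)) ∧ Set.InjOn Mor.rng (B : Set (Mor X)) := by
  obtain ⟨S, hS, hB⟩ := IsAmpleGroupoid.exists_basis (X := X)
  obtain ⟨B, hBS, hγB, hBO⟩ := hS.exists_subset_of_mem_open hγ hO
  obtain ⟨hc, ho, h1, h2⟩ := hB B hBS
  exact ⟨⟨⟨B, hc⟩, ho⟩, hγB, hBO, Set.injOn_iff_injective.2 h1.injective,
    Set.injOn_iff_injective.2 h2.injective⟩

/-- The range of a compact open set of morphisms. -/
def rangeOf (B : CompactOpens (Mor X)) : CompactOpens X :=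
  B.map Mor.rng continuous_rng isLocalHomeomorph_rng.isOpenMap

theorem coe_rangeOf (B : CompactOpens (Mor X)) :
    (rangeOf B : Set X) = Mor.rng '' (B : Set (Mor X)) := rfl

theorem unitIndicator_add_of_disjoint {U V : CompactOpens X} (h : Disjoint (U : Set X) V) :
    unitIndicator (U ⊔ V) = unitIndicator U + unitIndicator V := by
  refine DFunLike.ext _ _ fun x => ?_
  change unitIndicator (U ⊔ V) x = unitIndicator U x + unitIndicator V x
  by_cases hU : x ∈ U
  · have hV : x ∉ V := fun hV => Set.disjoint_left.1 h hU hV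
    rw [unitIndicator_of_mem hU, unitIndicator_of_notMem hV,
      unitIndicator_of_mem (show x ∈ U ⊔ V from Or.inl hU),
      add_zero]
  · by_cases hV : x ∈ V
    · rw [unitIndicator_of_mem hV, unitIndicator_of_notMem hU,
      unitIndicator_of_mem (show x ∈ U ⊔ V from Or.inr hV),
        zero_add]
    · rw [unitIndicator_of_notMem hV, unitIndicator_of_notMem hU, unitIndicator_of_notMem, add_zero]
      exact fun h => h.elim hU hV

theorem unitEmbedding_bot : unitEmbedding X (unitIndicator ⊥) = 0 := by
  have : unitIndicator (⊥ : CompactOpens X) = 0 :=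
    DFunLike.ext _ _ fun x => unitIndicator_of_notMem id
  rw [this, map_zero]

/-- In a minimal ample groupoid, the indicator of a compact open set of units is a sum of
translates of pieces of any other one that is nonempty. -/
theorem exists_list_sum_eq (hminimal : IsMinimal X) (U W : CompactOpens X)
    (hW : (W : Set X).Nonempty) : ∃ L : List (reducedCStarAlgebra X),
      (L.map fun v => v * unitEmbedding X (unitIndicator W) * star v).sum =
        unitEmbedding X (unitIndicator U) := by
  -- Compactness induction. The claim covers all compact open subsets `V` of `U'`, so that
  -- overlapping neighbourhoods can be cut into disjoint pieces.
  have key : ∃ U' : CompactOpens X, (U : Set X) ⊆ U' ∧ ∀ V : CompactOpens X, (V : Set X) ⊆ U' →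
      ∃ L : List (reducedCStarAlgebra X),
      (L.map fun v => v * unitEmbedding X (unitIndicator W) * star v).sum =
        unitEmbedding X (unitIndicator V) := by
    refine U.isCompact.induction_on (p := fun K => ∃ U' : CompactOpens X, K ⊆ U' ∧
      ∀ V : CompactOpens X, (V : Set X) ⊆ U' → ∃ L : List (reducedCStarAlgebra X),
      (L.map fun v => v * unitEmbedding X (unitIndicator W) * star v).sum =
        unitEmbedding X (unitIndicator V)) ?_ ?_ ?_ ?_
    · refine ⟨⊥, Set.empty_subset _, fun V hV => ⟨[], ?_⟩⟩
      obtain rfl : V = ⊥ := SetLike.coe_injective (Set.subset_empty_iff.1 hV)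
      rw [unitEmbedding_bot]
      rfl
    · rintro s t hst ⟨U', hU', h⟩
      exact ⟨U', hst.trans hU', h⟩
    · rintro s t ⟨U₁, hU₁, h₁⟩ ⟨U₂, hU₂, h₂⟩
      refine ⟨U₁ ⊔ U₂, Set.union_subset_union hU₁ hU₂, fun V hV => ?_⟩
      obtain ⟨L₁, hL₁⟩ := h₁ (V ⊓ U₁) Set.inter_subset_right
      obtain ⟨L₂, hL₂⟩ := h₂ (V \ U₁) fun x hx => (hV hx.1).resolve_left hx.2
      refine ⟨L₁ ++ L₂, ?_⟩
      rw [List.map_append, List.sum_append, hL₁, hL₂, ← map_add, ← unitIndicator_add_of_disjoint]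
      · congr 2
        exact SetLike.coe_injective (Set.inter_union_sdiff _ _)
      · exact Set.disjoint_left.2 fun x hx hx' => hx'.2 hx.2
    · intro x hx
      -- The orbit of `x` meets `W`, so a bisection `B` with sources in `W` has `x` in its range.
      -- Cutting `B` down to range `V` gives `C` with `1_C 1_W 1_C* = 1_C 1_C* = 1_V`.
      obtain ⟨y, ⟨g⟩, hyW⟩ := (hminimal x).exists_mem_open W.isOpen hW
      obtain ⟨B, hγ, hBO, hs, hr⟩ := exists_compactOpen_bisection
        (⟨y, x, Groupoid.inv g⟩ : Mor X) (W.isOpen.preimage continuous_src) hyW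
      refine ⟨_, mem_nhdsWithin_of_mem_nhds ((rangeOf B).isOpen.mem_nhds ⟨_, hγ, rfl⟩),
        rangeOf B, subset_rfl, fun V hV => ?_⟩
      have hcl : IsClosed (Mor.rng ⁻¹' (V : Set X) : Set (Mor X)) :=
        V.isCompact.isClosed.preimage continuous_rng
      let C : CompactOpens (Mor X) := ⟨⟨B ∩ Mor.rng ⁻¹' (V : Set X), B.isCompact.inter_right hcl⟩,
        B.isOpen.inter (V.isOpen.preimage continuous_rng)⟩
      have hC : (V : Set X) = Mor.rng '' (C : Set (Mor X)) := by
        change (V : Set X) = Mor.rng '' (B ∩ Mor.rng ⁻¹' (V : Set X))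
        rw [Set.image_inter_preimage, ← coe_rangeOf, Set.inter_eq_right.2 hV]
      refine ⟨[ofCc (indicatorCc C)], ?_⟩
      rw [List.map_singleton, List.sum_singleton, ofCc_mul_unitEmbedding, ofCc_indicator_mul_star
        (hs.mono Set.inter_subset_left) (hr.mono Set.inter_subset_left) hC]
      intro γ hγ
      have hγC : γ ∈ C := by
        by_contra h
        exact hγ (indicatorCc_of_notMem h)
      exact unitIndicator_of_mem (hBO hγC.1)
  obtain ⟨U', hU', h⟩ := key
  exact h U hU'

theorem _root_.TopologicalSpace.IsTopologicalBasis.exists_compactOpens {Y : Type*}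
    [TopologicalSpace Y] {𝔅 : Set (Set Y)} (hbasis : IsTopologicalBasis 𝔅)
    (hcompact : ∀ U ∈ 𝔅, IsCompact U) {y : Y} {O : Set Y} (hO : IsOpen O) (hy : y ∈ O) :
    ∃ V : CompactOpens Y, (V : Set Y) ∈ 𝔅 ∧ y ∈ V ∧ (V : Set Y) ⊆ O := by
  obtain ⟨V, hV, hyV, hVO⟩ := hbasis.exists_subset_of_mem_open hy hO
  exact ⟨⟨⟨V, hcompact V hV⟩, hbasis.isOpen hV⟩, hV, hyV, hVO⟩

theorem exists_compactOpens_superset {K : Set X} (hK : IsCompact K) :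
    ∃ U : CompactOpens X, K ⊆ U := by
  refine hK.induction_on ⟨⊥, Set.empty_subset _⟩ (fun s t hst ⟨U, hU⟩ => ⟨U, hst.trans hU⟩)
    (fun s t ⟨U, hU⟩ ⟨V, hV⟩ => ⟨U ⊔ V, Set.union_subset_union hU hV⟩) fun x _ => ?_
  obtain ⟨B, hB, -⟩ := exists_compactOpen_bisection (Mor.one x) isOpen_univ (Set.mem_univ _)
  exact ⟨_, mem_nhdsWithin_of_mem_nhds ((rangeOf B).isOpen.mem_nhds ⟨_, hB, rfl⟩), rangeOf B,
    subset_rfl⟩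

theorem exists_unitEmbedding_mul_eq (f : C_c(Mor X, ℂ)) :
    ∃ U : CompactOpens X, unitEmbedding X (unitIndicator U) * ofCc f = ofCc f := by
  obtain ⟨U, hU⟩ := exists_compactOpens_superset (f.hasCompactSupport.isCompact.image
    (continuous_rng (X := X)))
  exact ⟨U, unitEmbedding_mul_ofCc fun γ hγ =>
    unitIndicator_of_mem (hU ⟨γ, subset_closure hγ, rfl⟩)⟩

/-- Some column of `c` is nonzero, and the diagonal entry of `c* c` is the squared norm of that
column. -/
theorem exists_entry_star_mul_self_pos {c : reducedCStarAlgebra X} (hc : c ≠ 0) :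
    ∃ (x : X) (γ : Fiber x) (t : ℝ), 0 < t ∧ entry (star c * c) γ γ = t := by
  classical
  obtain ⟨x, ζ, γ, h⟩ : ∃ (x : X) (ζ γ : Fiber x), entry c ζ γ ≠ 0 := by
    by_contra! h
    exact hc (ext_entry fun x γ ζ => h x γ ζ)
  have hne : c.1.component x (lp.single 2 γ 1) ≠ 0 := fun h0 => h <| by
    unfold entry
    rw [h0]
    rfl
  refine ⟨x, γ, ‖c.1.component x (lp.single 2 γ 1)‖ ^ 2, by positivity, ?_⟩
  have h1 := ContinuousLinearMap.adjoint_inner_right (c.1.component x) (lp.single 2 γ 1)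
    (c.1.component x (lp.single 2 γ 1))
  rw [inner_self_eq_norm_sq_to_K, lp.inner_single_left] at h1
  simp only [RCLike.inner_apply, map_one, mul_one] at h1
  rw [Complex.ofReal_pow]
  exact h1

/-- In a topologically principal ample groupoid, the indicator of some basic open set of units is
dominated by a given nonzero positive element. -/
theorem exists_unit_below (hprincipal : IsTopologicallyPrincipal X)
    {𝔅 : Set (Set X)} (hbasis : IsTopologicalBasis 𝔅) (hcompact : ∀ U ∈ 𝔅, IsCompact U)
    {b : reducedCStarAlgebra X} (hb : IsPositive b) (hb0 : b ≠ 0) :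
    ∃ V : CompactOpens X, (V : Set X) ∈ 𝔅 ∧ (V : Set X).Nonempty ∧
      ∃ z, star z * b * z = unitEmbedding X (unitIndicator V) := by
  obtain ⟨c, rfl⟩ := hb
  have hc0 : c ≠ 0 := by
    rintro rfl
    simp at hb0
  obtain ⟨x, γ, t, ht, hγ⟩ := exists_entry_star_mul_self_pos hc0
  set b := star c * c with hb
  have hbs : IsSelfAdjoint b := .star_mul_self c
  -- One error of `t / 8` comes from replacing `b` by `f`, another from the deviation of `f` from
  -- `t` on `V`; the total `t / 4` is below `t`.
  obtain ⟨f, hf⟩ := exists_norm_sub_ofCc_lt b (ε := t / 8) (by positivity)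
  have hone : Continuous fun y : X => f (Mor.one y) :=
    f.continuous.comp isOpenEmbedding_one.continuous
  have hfγ : ‖f (Mor.one γ.1.rng) - t‖ < t / 8 := by
    have h1 := (norm_entry_le (b - ofCc f) γ γ).trans_lt hf
    rwa [entry_sub, hγ, entry_ofCc, Mor.mul_inv_self, norm_sub_rev] at h1
  have hOo : IsOpen {y : X | ‖f (Mor.one y) - t‖ < t / 8} :=
    isOpen_lt (hone.sub continuous_const).norm continuous_const
  obtain ⟨y, hyO, hy⟩ := hprincipal.exists_mem_open hOo ⟨_, hfγ⟩
  -- `K` is compact because the units are open. Trivial isotropy at `y` keeps `(y, y)` out of the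
  -- closed image of `K` under range and source, so a small `V` around `y` has no element of `K`
  -- with both ends in `V`.
  set K : Set (Mor X) := tsupport f \ Set.range Mor.one with hK
  have hKc : IsCompact K := f.hasCompactSupport.isCompact.diff isOpenEmbedding_one.isOpen_range
  have hKcl : IsClosed ((fun η : Mor X => (η.rng, η.src)) '' K) :=
    (hKc.image (continuous_rng.prodMk continuous_src)).isClosed
  have hyK : (y, y) ∉ (fun η : Mor X => (η.rng, η.src)) '' K := by
    rintro ⟨⟨a, c, g⟩, ⟨-, hη⟩, h⟩
    obtain rfl : c = y := congrArg Prod.fst h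
    obtain rfl : a = c := congrArg Prod.snd h
    exact hη ⟨_, by rw [Mor.one, hyO g]⟩
  obtain ⟨N₁, N₂, hN₁, hN₂, hy₁, hy₂, hN⟩ := isOpen_prod_iff.1 hKcl.isOpen_compl y y hyK
  obtain ⟨V, hV𝔅, hyV, hVsub⟩ := hbasis.exists_compactOpens hcompact
    ((hN₁.inter hN₂).inter hOo) ⟨⟨hy₁, hy₂⟩, hy⟩
  refine ⟨V, hV𝔅, ⟨y, hyV⟩, ?_⟩
  set q := unitEmbedding X (unitIndicator V) with hq
  have hqp : IsStarProjection q := isStarProjection_unitEmbedding V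
  have hcut := unit_mul_ofCc_mul_unit (V := V) (f := f) (fun η h0 h1 h2 => by
    by_contra hη
    exact hN ⟨(hVsub h1).1.1, (hVsub h2).1.2⟩ ⟨η, ⟨subset_closure h0, hη⟩, rfl⟩) hone.continuousOn
  rw [← hq] at hcut
  have h1 : ‖q * ofCc f * q - (t : ℂ) • q‖ ≤ t / 8 := by
    rw [hcut, hq, ← map_smul, ← map_sub]
    refine (norm_unitEmbedding_le _).trans ((BoundedContinuousFunction.norm_le (by positivity)).2
      fun u => ?_)
    change ‖cutoff V (fun x => f (Mor.one x)) hone.continuousOn u -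
      (t : ℂ) • unitIndicator V u‖ ≤ t / 8
    by_cases hu : u ∈ V
    · rw [cutoff_of_mem _ hu, unitIndicator_of_mem hu, smul_eq_mul, mul_one]
      exact (hVsub hu).2.le
    · rw [cutoff_of_notMem _ hu, unitIndicator_of_notMem hu, smul_zero, sub_zero, norm_zero]
      positivity
  have hqn : ‖q‖ ≤ 1 := hqp.norm_le
  have h2 : ‖q * b * q - q * ofCc f * q‖ ≤ t / 8 := by
    rw [← sub_mul, ← mul_sub]
    calc ‖q * (b - ofCc f) * q‖ ≤ ‖q‖ * ‖b - ofCc f‖ * ‖q‖ :=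
          (norm_mul_le _ _).trans (by gcongr; exact norm_mul_le _ _)
      _ ≤ 1 * (t / 8) * 1 := by gcongr
      _ = t / 8 := by ring
  have h3 : ‖q * b * q - (t : ℂ) • q‖ ≤ t / 4 := by
    have := norm_add_le_of_le h2 h1
    rw [sub_add_sub_cancel] at this
    linarith
  exact exists_star_mul_mul_eq_of_norm_sub_lt hqp hbs ht (h3.trans_lt (by linarith))

/-- The only arrow from `x` to itself is the unit, so the compression of `f ∈ C_c(G)` is `f(x)`
times the projection. Density suffices because a line is closed. -/
theorem exists_corner_eq_smul {U : CompactOpens X} {x : X} (hU : (U : Set X) = {x})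
    (hx : ∀ g : x ⟶ x, g = 𝟙 x) (a : reducedCStarAlgebra X) :
    ∃ α : ℂ, unitEmbedding X (unitIndicator U) * a * unitEmbedding X (unitIndicator U) =
      α • unitEmbedding X (unitIndicator U) := by
  set p := unitEmbedding X (unitIndicator U) with hp
  have hmem : ∀ y, y ∈ U ↔ y = x := fun y => by
    rw [← SetLike.mem_coe, hU, Set.mem_singleton_iff]
  have hcl : IsClosed {a : reducedCStarAlgebra X | p * a * p ∈ Submodule.span ℂ {p}} :=
    (Submodule.closed_of_finiteDimensional (Submodule.span ℂ {p})).preimage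
      ((continuous_const_mul p).mul continuous_const)
  have hmain : p * a * p ∈ Submodule.span ℂ {p} := by
    refine hcl.closure_subset (Metric.mem_closure_iff.2 fun ε hε => ?_)
    obtain ⟨f, hf⟩ := exists_norm_sub_ofCc_lt a hε
    refine ⟨ofCc f, ?_, by rwa [dist_eq_norm]⟩
    have hone : Continuous fun y : X => f (Mor.one y) :=
      f.continuous.comp isOpenEmbedding_one.continuous
    rw [Set.mem_ofPred_eq, hp, unit_mul_ofCc_mul_unit (fun γ _ h1 h2 => ?_) hone.continuousOn]
    · refine Submodule.mem_span_singleton.2 ⟨f (Mor.one x), ?_⟩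
      rw [← map_smul]
      congr 1
      refine DFunLike.ext _ _ fun y => ?_
      change f (Mor.one x) • unitIndicator U y = _
      by_cases hy : y ∈ U
      · rw [unitIndicator_of_mem hy, cutoff_of_mem _ hy, (hmem y).1 hy, smul_eq_mul, mul_one]
      · rw [unitIndicator_of_notMem hy, cutoff_of_notMem _ hy, smul_zero]
    · obtain ⟨c, d, g⟩ := γ
      obtain rfl : d = x := (hmem d).1 h1
      obtain rfl : c = d := (hmem c).1 h2
      exact ⟨_, by rw [Mor.one, hx g]⟩
  obtain ⟨α, hα⟩ := Submodule.mem_span_singleton.1 hmain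
  exact ⟨α, hα.symm⟩

end Ample
end EtaleGroupoid

namespace EtaleGroupoid

open TopologicalSpace (CompactOpens IsTopologicalBasis)

/-! ### Infinite projections and pure infiniteness. -/

section PureInfiniteness
variable {X : Type u} [Groupoid.{v} X] [TopologicalSpace X] [TopologicalSpace (Mor X)]
  [IsAmpleGroupoid X] [T2Space (Mor X)]

attribute [local instance] t2Space_unit

theorem exists_unit_below_gap (hprincipal : IsTopologicallyPrincipal X)
    {𝔅 : Set (Set X)} (hbasis : IsTopologicalBasis 𝔅) (hcompact : ∀ U ∈ 𝔅, IsCompact U)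
    {q s : reducedCStarAlgebra X} (hq : IsStarProjection q) (hs : star s * s = q)
    (hqs : q * (s * star s) = s * star s) (hne : s * star s ≠ q) :
    ∃ W : CompactOpens X, (W : Set X) ∈ 𝔅 ∧ (W : Set X).Nonempty ∧
      ∃ z, star z * (q - s * star s) * z = unitEmbedding X (unitIndicator W) := by
  exact exists_unit_below hprincipal hbasis hcompact (.sub_mul_star hq hs hqs)
    (sub_ne_zero.2 hne.symm)

/-- An infinite projection dominates every `1_U`: its gap dominates some `1_W`, `1_U` is a finite
sum of terms `v 1_W v*`, and these fit into orthogonal copies of the gap. -/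
theorem exists_star_mul_self_eq_unit (hprincipal : IsTopologicallyPrincipal X)
    (hminimal : IsMinimal X) {𝔅 : Set (Set X)} (hbasis : IsTopologicalBasis 𝔅)
    (hcompact : ∀ U ∈ 𝔅, IsCompact U) {q : reducedCStarAlgebra X} (hq : IsInfiniteProjection q)
    (U : CompactOpens X) :
    ∃ y, q * y = y ∧ star y * y = unitEmbedding X (unitIndicator U) := by
  obtain ⟨hqp, s, hs, hqs, hne⟩ := hq
  obtain ⟨W, -, hW, z, hz⟩ := exists_unit_below_gap hprincipal hbasis hcompact hqp hs hqs hne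
  obtain ⟨L, hL⟩ := exists_list_sum_eq hminimal U W hW
  rw [← hL]
  exact exists_star_mul_self_eq_list_sum hqp hs hqs hz L

theorem isEmpty_characterSpace_of_forall_isInfiniteProjection
    (hprincipal : IsTopologicallyPrincipal X)
    (hminimal : IsMinimal X) {𝔅 : Set (Set X)} (hbasis : IsTopologicalBasis 𝔅)
    (hcompact : ∀ U ∈ 𝔅, IsCompact U)
    (hinf : ∀ V : CompactOpens X, (V : Set X) ∈ 𝔅 → (V : Set X).Nonempty →
      IsInfiniteProjection (unitEmbedding X (unitIndicator V))) :
    IsEmpty (WeakDual.characterSpace ℂ (reducedCStarAlgebra X)) := by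
  refine ⟨fun φ => ?_⟩
  obtain ⟨a, ha⟩ : ∃ a, φ a ≠ 0 := by
    by_contra! h
    exact φ.2.1 (DFunLike.ext _ _ h)
  have ha0 : a ≠ 0 := by
    rintro rfl
    exact ha (map_zero φ)
  obtain ⟨V, hV𝔅, hV, -⟩ := exists_unit_below hprincipal hbasis hcompact ⟨a, rfl⟩
    ((CStarRing.star_mul_self_ne_zero_iff a).2 ha0)
  obtain ⟨hqp, s, hs, hqs, hne⟩ := hinf V hV𝔅 hV
  obtain ⟨W, hW𝔅, hW, z, hz⟩ :=
    exists_unit_below_gap hprincipal hbasis hcompact hqp hs hqs hne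
  -- The gap is the commutator `s* s - s s*`, on which a character vanishes.
  have hφW : φ (unitEmbedding X (unitIndicator W)) = 0 := by
    rw [← hz, ← hs, map_mul, map_mul, map_sub, map_mul, map_mul, mul_comm (φ s), sub_self,
      mul_zero, zero_mul]
  refine ha (isClosed_eq φ.1.continuous continuous_const |>.closure_subset
    (s := {a | φ a = 0}) (Metric.mem_closure_iff.2 fun ε hε => ?_))
  obtain ⟨f, hf⟩ := exists_norm_sub_ofCc_lt a hε
  refine ⟨ofCc f, ?_, by rwa [dist_eq_norm]⟩
  obtain ⟨U, hU⟩ := exists_unitEmbedding_mul_eq f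
  obtain ⟨y, hy1, hy2⟩ := exists_star_mul_self_eq_unit hprincipal hminimal hbasis hcompact
    (hinf W hW𝔅 hW) U
  change φ (ofCc f) = 0
  -- `1_W` is itself infinite, so `f = 1_U f = y* y f` with `y = 1_W y`, and `φ` kills the factor
  -- `1_W`.
  rw [← hU, ← hy2, ← hy1, map_mul, map_mul, map_mul φ _ y, hφW, zero_mul, mul_zero, zero_mul]

/-- Membership in the ideal matters only for `b = 0`. A nonzero `b` dominates an infinite `1_V`,
which dominates the local unit `1_U` of an approximant `f` of `c`, where `a = c* c`. -/
theorem cuntzBelow_of_forall_isInfiniteProjection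
    (hprincipal : IsTopologicallyPrincipal X)
    (hminimal : IsMinimal X) {𝔅 : Set (Set X)} (hbasis : IsTopologicalBasis 𝔅)
    (hcompact : ∀ U ∈ 𝔅, IsCompact U)
    (hinf : ∀ V : CompactOpens X, (V : Set X) ∈ 𝔅 → (V : Set X).Nonempty →
      IsInfiniteProjection (unitEmbedding X (unitIndicator V)))
    {a b : reducedCStarAlgebra X} (ha : IsPositive a) (hb : IsPositive b)
    (hab : a ∈ closedIdeal b) : CuntzBelow a b := by
  by_cases hb0 : b = 0
  · rw [hb0] at hab ⊢
    exact cuntzBelow_zero_of_mem_closedIdeal_zero hab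
  obtain ⟨V, hV𝔅, hV, z, hz⟩ := exists_unit_below hprincipal hbasis hcompact hb hb0
  obtain ⟨c, rfl⟩ := ha
  refine cuntzBelow_star_mul_self_of_approx fun ε hε => ?_
  obtain ⟨f, hf⟩ := exists_norm_sub_ofCc_lt c hε
  obtain ⟨U, hU⟩ := exists_unitEmbedding_mul_eq f
  obtain ⟨y, hy1, hy2⟩ := exists_star_mul_self_eq_unit hprincipal hminimal hbasis hcompact
    (hinf V hV𝔅 hV) U
  exact ⟨ofCc f, hf, z * (y * ofCc f), star_mul_mul_mul_eq hz hy1 hy2 hU⟩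

theorem isInfiniteProjection_of_isPurelyInfinite (hprincipal : IsTopologicallyPrincipal X)
    (hminimal : IsMinimal X) (hpi : IsPurelyInfinite (reducedCStarAlgebra X))
    {U : CompactOpens X} (hU : (U : Set X).Nonempty) :
    IsInfiniteProjection (unitEmbedding X (unitIndicator U)) := by
  obtain ⟨x, hx⟩ := hU
  have hUp := isStarProjection_unitEmbedding U
  -- The one-point case is contradictory. There `x` is isolated, so density of the units with
  -- trivial isotropy forces trivial isotropy at `x`, and the corner is one-dimensional.
  by_cases hsub : (U : Set X) ⊆ {x}
  · exfalso
    have hUx : (U : Set X) = {x} := hsub.antisymm (Set.singleton_subset_iff.2 hx)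
    have hmem : ∀ y, y ∈ U ↔ y = x := fun y => by
      rw [← SetLike.mem_coe, hUx, Set.mem_singleton_iff]
    have hxi : ∀ g : x ⟶ x, g = 𝟙 x := by
      obtain ⟨y, hy, hyU⟩ := hprincipal.exists_mem_open U.isOpen ⟨x, hx⟩
      obtain rfl : y = x := hsub hyU
      exact hy
    have hU0 := unitEmbedding_ne_zero ⟨x, hx⟩
    have hcorner := exists_corner_eq_smul hUx hxi
    by_cases hX : ∃ y, y ≠ x
    · obtain ⟨y, hy⟩ := hX
      obtain ⟨x', ⟨g⟩, hx'⟩ := (hminimal y).exists_mem_open U.isOpen ⟨x, hx⟩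
      obtain rfl : x' = x := hsub hx'
      obtain ⟨B, hγ, hBO, hs, hr⟩ := exists_compactOpen_bisection (⟨y, x', g⟩ : Mor X)
        (U.isOpen.preimage continuous_rng) hx
      have hB : ∀ η : Mor X, indicatorCc B η ≠ 0 → η ∈ B := fun η h => by
        by_contra h'
        exact h (indicatorCc_of_notMem h')
      have hBr : (U : Set X) = Mor.rng '' (B : Set (Mor X)) := by
        refine Set.Subset.antisymm ?_ ?_
        · rw [hUx]
          rintro _ rfl
          exact ⟨_, hγ, rfl⟩
        · rintro _ ⟨η, hη, rfl⟩
          exact hBO hη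
      set u := ofCc (indicatorCc B) with hu
      have huu : u * star u = unitEmbedding X (unitIndicator U) :=
        ofCc_indicator_mul_star hs hr hBr
      have hup : u * unitEmbedding X (unitIndicator U) = 0 := by
        -- All of `B` has range in the one-point set `U`, so by injectivity `B` is a single arrow,
        -- with source `y` outside `U`.
        refine ofCc_mul_unitEmbedding_eq_zero fun η hη => unitIndicator_of_notMem fun hηU => hy ?_
        have h1 : η.rng = x' := hsub (hBO (hB η hη))
        have h2 : η = ⟨y, x', g⟩ := hr (hB η hη) hγ h1
        rw [h2] at hηU
        exact (hmem y).1 hηU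
      have hpu : unitEmbedding X (unitIndicator U) * u = u :=
        unitEmbedding_mul_ofCc fun η hη => unitIndicator_of_mem (hBO (hB η hη))
      set p := unitEmbedding X (unitIndicator U) with hp
      refine not_cuntzBelow_of_minimal hUp hU0 hcorner huu hup ?_
      have hps := hUp.isSelfAdjoint.star_eq
      have hpp := hUp.isIdempotentElem.eq
      have hpus : p * star u = 0 := by simpa [hps] using congrArg star hup
      -- Both summands lie in the ideal of `p`, since `p = p p p` and `u* u = u* p u`; pure
      -- infiniteness would then put the sum below `p`.
      refine (hpi.2 _ _ ⟨p + star u * u, ?_⟩ hUp.isPositive).2 (subset_closure ?_)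
      · have h1 : star u * u * (star u * u) = star u * u := by
          rw [mul_assoc, ← mul_assoc u, huu, hpu]
        simp only [star_add, star_mul, star_star, hps, add_mul, mul_add, hpp, h1]
        rw [← mul_assoc p, hpus, mul_assoc _ u p, hup]
        simp
      · refine Submodule.add_mem _ (Submodule.subset_span ⟨p, p, ?_⟩)
          (Submodule.subset_span ⟨star u, u, ?_⟩)
        · rw [hpp, hpp]
        · rw [mul_assoc, hpu]
    -- With a single unit, `1_U` is the identity, so the algebra equals its corner `ℂ`.
    · push Not at hX
      have hunit : ∀ a : reducedCStarAlgebra X, unitEmbedding X (unitIndicator U) * a = a :=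
        fun a => ext_entry fun z γ ζ => by
          rw [entry_unitEmbedding_mul, unitIndicator_of_mem ((hmem _).2 (hX _)), one_mul]
      have hunit' : ∀ a : reducedCStarAlgebra X, a * unitEmbedding X (unitIndicator U) = a :=
        fun a => ext_entry fun z γ ζ => by
          rw [entry_mul_unitEmbedding, unitIndicator_of_mem ((hmem _).2 (hX _)), mul_one]
      obtain ⟨φ⟩ := nonempty_characterSpace_of_forall_eq_smul hUp hU0 fun a => by
        obtain ⟨α, hα⟩ := hcorner a
        exact ⟨α, by rw [← hα, hunit, hunit']⟩
      exact hpi.1.false φ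
  · obtain ⟨y, hyU, hyx⟩ := Set.not_subset.1 hsub
    -- The range of `B` is a compact open neighbourhood of `x` inside `U` that misses `y`; it
    -- provides the proper subprojection.
    obtain ⟨B, hB, hBO, -, -⟩ := exists_compactOpen_bisection (Mor.one x)
      ((U.isOpen.sdiff (isClosed_singleton (x := y))).preimage continuous_rng)
      ⟨hx, fun h => hyx h.symm⟩
    have hVU : ∀ z ∈ rangeOf B, z ∈ U ∧ z ≠ y := by
      rintro _ ⟨η, hη, rfl⟩
      exact hBO hη
    have hxV : x ∈ rangeOf B := ⟨_, hB, rfl⟩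
    set V := rangeOf B
    obtain ⟨L, hL⟩ := exists_list_sum_eq hminimal U V ⟨x, hxV⟩
    have hmul : unitIndicator U * unitIndicator V = unitIndicator V := by
      refine DFunLike.ext _ _ fun z => ?_
      change unitIndicator U z * unitIndicator V z = unitIndicator V z
      by_cases hz : z ∈ V
      · rw [unitIndicator_of_mem (hVU z hz).1, one_mul]
      · rw [unitIndicator_of_notMem hz, mul_zero]
    refine isInfiniteProjection_of_cuntzBelow hUp (isStarProjection_unitEmbedding V)
      (by rw [← map_mul, hmul]) (fun h => ?_)
      ((hpi.2 _ _ hUp.isPositive (isStarProjection_unitEmbedding V).isPositive).2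
        (subset_closure ?_))
    · have h1 := entry_unitEmbedding (unitIndicator V) (⟨Mor.one y, rfl⟩ : Fiber y) ⟨Mor.one y, rfl⟩
      rw [h, entry_unitEmbedding, if_pos rfl, if_pos rfl, Mor.one_rng, unitIndicator_of_mem hyU,
        unitIndicator_of_notMem fun h => (hVU y h).2 rfl] at h1
      exact one_ne_zero h1
    · rw [← hL]
      refine list_sum_mem fun w hw => ?_
      obtain ⟨v, -, rfl⟩ := List.mem_map.1 hw
      exact Submodule.subset_span ⟨v, star v, rfl⟩

end PureInfiniteness
end EtaleGroupoid

theorem theorem4p1 {X : Type u} [Groupoid.{v} X] [TopologicalSpace X]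
    [TopologicalSpace (EtaleGroupoid.Mor X)]
    [SecondCountableTopology (EtaleGroupoid.Mor X)] [T2Space (EtaleGroupoid.Mor X)]
    [EtaleGroupoid.IsAmpleGroupoid X]
    (hprincipal : EtaleGroupoid.IsTopologicallyPrincipal X)
    (hminimal : EtaleGroupoid.IsMinimal X)
    (𝔅 : Set (Set X)) (hbasis : TopologicalSpace.IsTopologicalBasis 𝔅)
    (hcompact : ∀ U ∈ 𝔅, IsCompact U) :
    EtaleGroupoid.IsPurelyInfinite (EtaleGroupoid.reducedCStarAlgebra X) ↔
      ∀ p : C₀(X, ℂ), IsStarProjection p → p ≠ 0 → tsupport p ∈ 𝔅 →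
        EtaleGroupoid.IsInfiniteProjection (EtaleGroupoid.unitEmbedding X p) := by
  have : T2Space X := EtaleGroupoid.t2Space_unit
  refine ⟨fun hpi p hp hp0 hsupp => ?_, fun h => ?_⟩
  · obtain ⟨U, rfl⟩ := EtaleGroupoid.exists_eq_unitIndicator hp (hcompact _ hsupp)
    refine EtaleGroupoid.isInfiniteProjection_of_isPurelyInfinite hprincipal hminimal hpi
      (Set.nonempty_iff_ne_empty.2 fun hU => hp0 (DFunLike.ext _ _ fun x => ?_))
    exact EtaleGroupoid.unitIndicator_of_notMem fun hx => hU.subset hx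
  · have hinf : ∀ V : TopologicalSpace.CompactOpens X, (V : Set X) ∈ 𝔅 → (V : Set X).Nonempty →
        EtaleGroupoid.IsInfiniteProjection
          (EtaleGroupoid.unitEmbedding X (EtaleGroupoid.unitIndicator V)) := by
      rintro V hV ⟨x, hx⟩
      refine h _ (EtaleGroupoid.isStarProjection_unitIndicator V) (fun h0 => ?_)
        (by rwa [EtaleGroupoid.tsupport_unitIndicator])
      have h1 := EtaleGroupoid.unitIndicator_of_mem hx
      rw [h0] at h1
      exact zero_ne_one h1
    exact ⟨EtaleGroupoid.isEmpty_characterSpace_of_forall_isInfiniteProjection hprincipal hminimal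
      hbasis hcompact hinf, fun a b ha hb => ⟨EtaleGroupoid.CuntzBelow.mem_closedIdeal,
      EtaleGroupoid.cuntzBelow_of_forall_isInfiniteProjection hprincipal hminimal hbasis hcompact
        hinf ha hb⟩⟩
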